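/- Let $p$ be a prime and $n\ge 1$ an integer. In an algebraic closure of $\mathbb{Q}_p$ fix primitive $p^k$-th roots of unity $\zeta_{p^k}$ ($k\ge 0$) with $\zeta_{p^{k+1}}^p=\zeta_{p^k}$. Let $E_p(t)=\exp\left(\sum_{i\ge 0}t^{p^i}/p^i\right)$ be the Artin--Hasse exponential and, for $k\ge 1$, put $$E_{k,p}(t)=\frac{E_p(\zeta_{p^k}t)}{E_p(t)},\qquad F_{k,p}(t)=\frac{E_{k,p}(t)}{E_{k,p}(t^p)}.$$ Let $R=\mathbb{Z}_p[\zeta_{p^n}][[a_0,\dots,a_{n-1},b_0,\dots,b_{n-1}]]$, and let $W_n(R)$ be the ring of $p$-typical Witt vectors of length $n$ over $R$. For $\underline{x}=(x_0,\dots,x_{n-1})\in W_n(R)$ put $\sigma(\underline{x})=(x_0^p,\dots,x_{n-1}^p)$ and $$E_{n,p}(\underline{x})=\prod_{i=0}^{n-1}E_{n-i,p}(x_i),\qquad F_{n,p}(\underline{x})=\prod_{i=0}^{n-1}F_{n-i,p}(x_i),$$ whenever the series on the right, evaluated at the $x_i$, converge coefficientwise in the $p$-adic topology. Let $\underline{a}=(a_0,\dots,a_{n-1})$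 and $\underline{b}=(b_0,\dots,b_{n-1})$ be the Witt vectors of variables, and regard an integer $m$ as the element $m\cdot 1$ of $W_n(R)$. Then for every $m\in\mathbb{Z}$ the series defining $F_{n,p}(\underline{a}+\underline{b}+m)$, $F_{n,p}(\underline{a})$, $F_{n,p}(\underline{b})$, $E_{n,p}(\sigma(\underline{a}+\underline{b}+m)-\sigma(\underline{a})-\underline{b}-m)$ and $E_{n,p}(\sigma(\underline{a}+\underline{b}+m)-\sigma(\underline{a})-\sigma(\underline{b})-m)$ converge; the values of $F_{n,p}(\underline{a}+\underline{b}+m)$ and of the two $E_{n,p}$ expressions, and the inverses $F_{n,p}(\underline{a})^{-1}$ and $F_{n,p}(\underline{b})^{-1}$, lie in $R$; and the following equalities hold in $R$: $$F_{n,p}(\underline{a}+\underline{b}+m)\,F_{n,p}(\underline{a})^{-1}\,E_{n,p}\bigl(\sigma(\underline{a}+\underline{b}+m)-\sigma(\underline{a})-\underline{b}-m\bigr)=\zeta_{p^n}^m,$$ $$F_{n,p}(\underline{a}+\underline{b}+m)\,F_{n,p}(\underline{a})^{-1}\,F_{n,p}(\underline{b})^{-1}\,E_{n,p}\bigl(\sigma(\underline{a}+\underline{b}+m)-\sigma(\underline{a})-\sigma(\underline{b})-m\bigr)=\zeta_{p^n}^m.$$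 -/

import Mathlib

open scoped MvPowerSeries.WithPiTopology

noncomputable section

namespace ArtinHasse

/-- The series `∑ i, t ^ (p ^ i) / p ^ i`. -/
def logSeries (p : ℕ) (K : Type*) [Field K] : PowerSeries K :=
  PowerSeries.mk fun k =>
    ∑ i ∈ Finset.range (k + 1), if k = p ^ i then ((p : K) ^ i)⁻¹ else 0

/-- The Artin-Hasse exponential series `E_p(t) = exp (∑ i, t ^ (p ^ i) / p ^ i)`. -/
def artinHasse (p : ℕ) (K : Type*) [Field K] [CharZero K] : PowerSeries K :=
  (PowerSeries.exp K).subst (logSeries p K)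

variable (p : ℕ) [Fact p.Prime]

/-- The series `E_p(z t) / E_p(t)`; for `z` a primitive `p ^ k`-th root of unity
this is `E_{k,p}(t)`. -/
def E (z : PadicAlgCl p) : PowerSeries (PadicAlgCl p) :=
  PowerSeries.rescale z (artinHasse p (PadicAlgCl p)) * (artinHasse p (PadicAlgCl p))⁻¹

/-- The series `E_{k,p}(t) / E_{k,p}(t ^ p)`, where `z` is a primitive `p ^ k`-th root of unity;
that is, `F_{k,p}(t)`. -/
def F (z : PadicAlgCl p) : PowerSeries (PadicAlgCl p) :=
  E p z * (PowerSeries.expand p (Fact.out : p.Prime).ne_zero (E p z))⁻¹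

/-- The ring `ℤ_p[z]` inside the algebraic closure of `ℚ_p`. -/
abbrev ZpAdjoin (z : PadicAlgCl p) : Subalgebra ℤ_[p] (PadicAlgCl p) :=
  Algebra.adjoin ℤ_[p] {z}

/-- The ring `ℤ_p[z]⟦a_0, …, a_{n-1}, b_0, …, b_{n-1}⟧`, where `a_i` is the variable `inl i` and
`b_i` is the variable `inr i`. -/
abbrev IntSeries (n : ℕ) (z : PadicAlgCl p) : Type :=
  MvPowerSeries (Fin n ⊕ Fin n) (ZpAdjoin p z)

/-- The power series in the same variables with coefficients in the algebraic closure of `ℚ_p`. -/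
abbrev FieldSeries (n : ℕ) : Type :=
  MvPowerSeries (Fin n ⊕ Fin n) (PadicAlgCl p)

/-- The inclusion of `ℤ_p[z]⟦a, b⟧` into the power series over the field. -/
def incl (n : ℕ) (z : PadicAlgCl p) : IntSeries p n z →+* FieldSeries p n :=
  MvPowerSeries.map (algebraMap (ZpAdjoin p z) (PadicAlgCl p))

/-- The terms `f_k x ^ k` of the evaluation of `f = ∑ f_k t ^ k` at `t = x`. -/
def monoTerm {n : ℕ} {z : PadicAlgCl p} (f : PowerSeries (PadicAlgCl p)) (x : IntSeries p n z)
    (k : ℕ) : FieldSeries p n :=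
  PowerSeries.coeff k f • incl p n z x ^ k

/-- The series `∑ f_k x ^ k` converges, coefficient by coefficient for the `p`-adic topology. -/
def Converges {n : ℕ} {z : PadicAlgCl p} (f : PowerSeries (PadicAlgCl p))
    (x : IntSeries p n z) : Prop :=
  Summable (monoTerm p f x)

/-- The value `f(x) = ∑ f_k x ^ k`, summed coefficient by coefficient for the `p`-adic topology. -/
def evalAt {n : ℕ} {z : PadicAlgCl p} (f : PowerSeries (PadicAlgCl p)) (x : IntSeries p n z) :
    FieldSeries p n :=
  ∑' k, monoTerm p f x k

/-- Truncated Witt vectors of length `n` over `ℤ_p[z]⟦a, b⟧`. -/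
abbrev Witt (n : ℕ) (z : PadicAlgCl p) : Type :=
  TruncatedWittVector p n (IntSeries p n z)

/-- The Witt vector `(a_0, …, a_{n-1})` of variables. -/
def wittA (n : ℕ) (z : PadicAlgCl p) : Witt p n z :=
  TruncatedWittVector.mk p fun i => MvPowerSeries.X (Sum.inl i)

/-- The Witt vector `(b_0, …, b_{n-1})` of variables. -/
def wittB (n : ℕ) (z : PadicAlgCl p) : Witt p n z :=
  TruncatedWittVector.mk p fun i => MvPowerSeries.X (Sum.inr i)

/-- `σ(x) = (x_0 ^ p, …, x_{n-1} ^ p)`. -/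
def sigma {n : ℕ} {z : PadicAlgCl p} (x : Witt p n z) : Witt p n z :=
  TruncatedWittVector.mk p fun i => x.coeff i ^ p

variable (ζ : ℕ → PadicAlgCl p) {n : ℕ}

/-- All the series in the product defining `E_{n,p}(x)` converge. -/
def EConverges (x : Witt p n (ζ n)) : Prop :=
  ∀ i : Fin n, Converges p (E p (ζ (n - i))) (x.coeff i)

/-- `E_{n,p}(x) = ∏ i, E_{n-i,p}(x_i)`. -/
def EWitt (x : Witt p n (ζ n)) : FieldSeries p n :=
  ∏ i : Fin n, evalAt p (E p (ζ (n - i))) (x.coeff i)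

/-- All the series in the product defining `F_{n,p}(x)` converge. -/
def FConverges (x : Witt p n (ζ n)) : Prop :=
  ∀ i : Fin n, Converges p (F p (ζ (n - i))) (x.coeff i)

/-- `F_{n,p}(x) = ∏ i, F_{n-i,p}(x_i)`. -/
def FWitt (x : Witt p n (ζ n)) : FieldSeries p n :=
  ∏ i : Fin n, evalAt p (F p (ζ (n - i))) (x.coeff i)

/-- The subring of the series all of whose coefficients lie in `ℤ_p[z]`. -/
def integralSeries (n : ℕ) (z : PadicAlgCl p) : Subring (FieldSeries p n) :=
  (incl p n z).range

end ArtinHasse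

end

noncomputable section

namespace ArtinHasse

open PowerSeries Filter Topology

/-! ### Logarithmic derivatives of power series. -/

section LogDeriv

variable {A B : Type*} [CommRing A] [CommRing B]

/-! The engine is the logarithmic derivative `t f'/f`, which for the Artin-Hasse series is `∑
t^(p^i)`. With `ω = ζ_{p^n}`, attach to a Witt vector `x` the series `∏ E_{n-i,p}(x_i T^(p^i))` in
an auxiliary variable `T`. Its logarithmic derivative is `∑ (ω^(p^l) - 1) w_l(x) T^(p^l)`, where the
ghost components `w_l` are additive; over a torsion-free ring the series is therefore multiplicative
in `x` (`ESeries_add`). Since `F(t) = E(t)/E(t^p)`, the analogous product for `F` is multiplicative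
up to the correction `E(σ(x+y) - σ(x) - σ(y))` taken at `T^p` (`FSeries_add`).

The identities come from setting `T = 1`, and convergence is the issue. `E` can be evaluated at
topologically nilpotent coordinates, and the correction has such coordinates because the residue
field of `ℤ_p[ω]` is `𝔽_p`, so that `σ` is the identity modulo topological nilpotents. `F` can be
evaluated everywhere: the coefficients of `F_z` are summable, with sum `z`, when `z` is close to `1`
(`hasCoeffSum_FInt`). Indeed for `z = 1 + X` with `X` an indeterminate, the value at `t = 1`, taken
coefficientwise in `X`, satisfies `(1 + X) dF/dX = F` and is `1` at `X = 0`, so it is `1 + X`.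

Hence `m ↦ F(m) E(σ(m) - m)` is multiplicative on `ℤ` and sends `1` to `F_ω(1) = ω` (`intHom`).
Splitting `a + b + m` by the additivity of `F` gives the second identity. The first follows from it
and from `F(b) E(σ(b)) = E(b)`, which makes sense because the variables `b_i` are topologically
nilpotent. -/

theorem coeff_X_mul_derivative (f : PowerSeries A) (k : ℕ) :
    coeff k (X * derivative A f) = k * coeff k f := by
  cases k with
  | zero => simp
  | succ k => rw [coeff_succ_X_mul, coeff_derivative]; push_cast; ring

/-- `f` has constant term `1` and logarithmic derivative `X f' / f` equal to `h`. -/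
structure HasLogDeriv (f h : PowerSeries A) : Prop where
  constantCoeff_eq : constantCoeff f = 1
  X_mul_derivative : X * derivative A f = f * h

namespace HasLogDeriv

theorem one : HasLogDeriv (1 : PowerSeries A) 0 := ⟨by simp, by simp⟩

theorem mul {f g h k : PowerSeries A} (hf : HasLogDeriv f h) (hg : HasLogDeriv g k) :
    HasLogDeriv (f * g) (h + k) := by
  refine ⟨by simp [hf.1, hg.1], ?_⟩
  rw [Derivation.leibniz, smul_eq_mul, smul_eq_mul]
  linear_combination f * hg.2 + g * hf.2

theorem pow {f h : PowerSeries A} (hf : HasLogDeriv f h) (n : ℕ) :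
    HasLogDeriv (f ^ n) (n * h) := by
  induction n with
  | zero => simpa using one
  | succ n ih =>
    rw [pow_succ]
    convert ih.mul hf using 1
    push_cast; ring

theorem prod {ι : Type*} (s : Finset ι) {f h : ι → PowerSeries A}
    (hf : ∀ i ∈ s, HasLogDeriv (f i) (h i)) :
    HasLogDeriv (∏ i ∈ s, f i) (∑ i ∈ s, h i) := by
  classical
  induction s using Finset.induction_on with
  | empty => simpa using one
  | insert i s hi ih =>
    rw [Finset.prod_insert hi, Finset.sum_insert hi]
    exact (hf i (Finset.mem_insert_self i s)).mul
      (ih fun j hj => hf j (Finset.mem_insert_of_mem hj))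

theorem of_mul_eq_one {f g h : PowerSeries A} (hf : HasLogDeriv f h) (hfg : f * g = 1) :
    HasLogDeriv g (-h) := by
  refine ⟨by simpa [hf.1] using congrArg constantCoeff hfg, ?_⟩
  have := congrArg (derivative A) hfg
  rw [Derivation.leibniz, smul_eq_mul, smul_eq_mul, derivative_one] at this
  linear_combination (-(X * derivative A g)) * hfg + g * X * this - g ^ 2 * hf.2
    + g * h * (-hfg)

theorem map {f h : PowerSeries A} (hf : HasLogDeriv f h) (φ : A →+* B) :
    HasLogDeriv (PowerSeries.map φ f) (PowerSeries.map φ h) := by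
  refine ⟨by rw [← coeff_zero_eq_constantCoeff_apply, coeff_map,
    coeff_zero_eq_constantCoeff_apply, hf.1, map_one], ?_⟩
  rw [← map_mul, ← hf.2]
  ext k
  rw [coeff_X_mul_derivative, coeff_map, coeff_map, coeff_X_mul_derivative, map_mul, map_natCast]

theorem of_map {f h : PowerSeries A} {φ : A →+* B} (hφ : Function.Injective φ)
    (hf : HasLogDeriv (PowerSeries.map φ f) (PowerSeries.map φ h)) : HasLogDeriv f h := by
  refine ⟨hφ ?_, map_injective φ hφ ?_⟩
  · rw [map_one, ← hf.1, ← coeff_zero_eq_constantCoeff_apply, ← coeff_zero_eq_constantCoeff_apply,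
      coeff_map]
  · rw [map_mul (PowerSeries.map φ) f h, ← hf.2]
    ext k
    rw [coeff_X_mul_derivative, coeff_map, coeff_map, coeff_X_mul_derivative, map_mul, map_natCast]

theorem rescale {f h : PowerSeries A} (hf : HasLogDeriv f h) (c : A) :
    HasLogDeriv (PowerSeries.rescale c f) (PowerSeries.rescale c h) := by
  refine ⟨by rw [← coeff_zero_eq_constantCoeff_apply, coeff_rescale,
    coeff_zero_eq_constantCoeff_apply, hf.1]; simp, ?_⟩
  rw [← map_mul, ← hf.2]
  ext k
  simp only [coeff_X_mul_derivative, coeff_rescale]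
  ring

theorem expand {f h : PowerSeries A} (hf : HasLogDeriv f h) (q : ℕ) (hq : q ≠ 0) :
    HasLogDeriv (PowerSeries.expand q hq f) (q * PowerSeries.expand q hq h) := by
  refine ⟨by rw [constantCoeff_expand, hf.1], ?_⟩
  rw [mul_left_comm, ← map_mul, ← hf.2]
  ext k
  rw [coeff_X_mul_derivative, ← nsmul_eq_mul q, map_nsmul, nsmul_eq_mul, coeff_expand, coeff_expand]
  split_ifs with hk
  · obtain ⟨j, rfl⟩ := hk
    rw [Nat.mul_div_cancel_left _ (Nat.pos_of_ne_zero hq), coeff_X_mul_derivative]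
    push_cast; ring
  · simp

theorem exists_mul_eq_one {f h : PowerSeries A} (hf : HasLogDeriv f h) : ∃ g, f * g = 1 :=
  ⟨invOfUnit f 1, mul_invOfUnit f 1 (by simp [hf.1])⟩

/-- The quotient `f / g` has zero derivative and constant term `1`; torsion-freeness turns `k * c =
0` into `c = 0`. Every functional equation below is proved through this. -/
theorem unique [IsAddTorsionFree A] {f g h : PowerSeries A} (hf : HasLogDeriv f h)
    (hg : HasLogDeriv g h) : f = g := by
  obtain ⟨g', hg'⟩ := hg.exists_mul_eq_one
  have h0 : HasLogDeriv (f * g') 0 := by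
    simpa using hf.mul (hg.of_mul_eq_one hg')
  have h1 : f * g' = 1 := by
    refine derivative.ext ?_ (by rw [h0.1, map_one])
    rw [derivative_one]
    ext k
    have := congrArg (coeff (k + 1)) h0.2
    simpa [coeff_succ_X_mul] using this
  linear_combination g * h1 - f * hg'

end HasLogDeriv

end LogDeriv

/-! ### Series supported on powers of `p`. -/

section PSeries

variable (p : ℕ) {A B : Type*} [CommRing A] [CommRing B]

/-- The series `∑ i, u i * t ^ (p ^ i)`. -/
def pSeries (u : ℕ → A) : PowerSeries A :=
  PowerSeries.mk fun k => ∑ i ∈ Finset.range (k + 1), if k = p ^ i then u i else 0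

theorem logSeries_eq_pSeries (K : Type*) [Field K] :
    logSeries p K = pSeries p fun i => ((p : K) ^ i)⁻¹ := rfl

theorem coeff_pSeries (u : ℕ → A) (k : ℕ) :
    coeff k (pSeries p u) = ∑ i ∈ Finset.range (k + 1), if k = p ^ i then u i else 0 :=
  coeff_mk _ _

theorem coeff_pSeries_of_ne (u : ℕ → A) {k : ℕ} (h : ∀ i, k ≠ p ^ i) :
    coeff k (pSeries p u) = 0 := by
  rw [coeff_pSeries]
  exact Finset.sum_eq_zero fun i _ => if_neg (h i)

variable [hp : Fact p.Prime]

theorem coeff_pow_pSeries (u : ℕ → A) (i : ℕ) : coeff (p ^ i) (pSeries p u) = u i := by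
  rw [coeff_pSeries, Finset.sum_eq_single i]
  · simp
  · intro j _ hj
    exact if_neg fun h => hj (Nat.pow_right_injective hp.out.two_le h).symm
  · intro h
    exact absurd (Finset.mem_range.2 ((Nat.lt_pow_self hp.out.one_lt).trans (Nat.lt_succ_self _))) h

theorem ext_pSeries {f : PowerSeries A} {u : ℕ → A} (h : ∀ i, coeff (p ^ i) f = u i)
    (h' : ∀ k, (∀ i, k ≠ p ^ i) → coeff k f = 0) : f = pSeries p u := by
  ext k
  by_cases hk : ∃ i, k = p ^ i
  · obtain ⟨i, rfl⟩ := hk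
    rw [h, coeff_pow_pSeries]
  · push Not at hk
    rw [h' k hk, coeff_pSeries_of_ne p u hk]

theorem constantCoeff_pSeries (u : ℕ → A) : constantCoeff (pSeries p u) = 0 := by
  rw [← coeff_zero_eq_constantCoeff_apply]
  exact coeff_pSeries_of_ne p u fun i => (pow_pos hp.out.pos i).ne

theorem map_pSeries (φ : A →+* B) (u : ℕ → A) :
    PowerSeries.map φ (pSeries p u) = pSeries p fun i => φ (u i) := by
  refine ext_pSeries p (fun i => by rw [coeff_map, coeff_pow_pSeries]) fun k hk => ?_
  rw [coeff_map, coeff_pSeries_of_ne p u hk, map_zero]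

theorem rescale_pSeries (c : A) (u : ℕ → A) :
    PowerSeries.rescale c (pSeries p u) = pSeries p fun i => c ^ p ^ i * u i := by
  refine ext_pSeries p (fun i => by rw [coeff_rescale, coeff_pow_pSeries]) fun k hk => ?_
  rw [coeff_rescale, coeff_pSeries_of_ne p u hk, mul_zero]

theorem pSeries_add (u v : ℕ → A) : pSeries p u + pSeries p v = pSeries p (u + v) := by
  refine ext_pSeries p (fun i => by simp [coeff_pow_pSeries]) fun k hk => ?_
  simp [coeff_pSeries_of_ne p _ hk]

theorem pSeries_neg (u : ℕ → A) : -pSeries p u = pSeries p (-u) := by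
  refine ext_pSeries p (fun i => by simp [coeff_pow_pSeries]) fun k hk => ?_
  simp [coeff_pSeries_of_ne p _ hk]

theorem sum_pSeries {ι : Type*} (s : Finset ι) (u : ι → ℕ → A) :
    ∑ i ∈ s, pSeries p (u i) = pSeries p fun l => ∑ i ∈ s, u i l := by
  refine ext_pSeries p (fun i => by simp [coeff_pow_pSeries]) fun k hk => ?_
  simp [coeff_pSeries_of_ne p _ hk]

theorem natCast_mul_pSeries (c : ℕ) (u : ℕ → A) :
    (c : PowerSeries A) * pSeries p u = pSeries p fun i => c * u i := by
  rw [← nsmul_eq_mul]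
  refine ext_pSeries p (fun i => ?_) fun k hk => ?_
  · rw [map_nsmul, coeff_pow_pSeries, nsmul_eq_mul]
  · rw [map_nsmul, coeff_pSeries_of_ne p _ hk, smul_zero]

theorem expand_pSeries (j : ℕ) (hj : p ^ j ≠ 0) (u : ℕ → A) :
    PowerSeries.expand (p ^ j) hj (pSeries p u) =
      pSeries p fun i => if i < j then 0 else u (i - j) := by
  refine ext_pSeries p (fun i => ?_) fun k hk => ?_
  · rw [coeff_expand]
    rcases lt_or_ge i j with h | h
    · rw [if_pos h, if_neg]
      exact fun hd => h.not_ge ((Nat.pow_dvd_pow_iff_le_right hp.out.one_lt).1 hd)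
    · rw [if_neg h.not_gt, if_pos (pow_dvd_pow p h), Nat.pow_div h hp.out.pos, coeff_pow_pSeries]
  · rw [coeff_expand]
    split_ifs with hd
    · obtain ⟨m, rfl⟩ := hd
      rw [Nat.mul_div_cancel_left _ (Nat.pos_of_ne_zero hj)]
      refine coeff_pSeries_of_ne p u fun i hi => hk (j + i) ?_
      rw [hi, pow_add]
    · rfl

theorem expand_prime_pSeries (hj : p ≠ 0) (u : ℕ → A) :
    PowerSeries.expand p hj (pSeries p u) =
      pSeries p fun i => if i = 0 then 0 else u (i - 1) := by
  have := expand_pSeries p 1 (by simpa using hj) u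
  simpa using this

theorem pSeries_sub_expand (u : ℕ → A) (hj : p ≠ 0) :
    pSeries p u - PowerSeries.expand p hj (pSeries p u) =
      pSeries p fun i => if i = 0 then u 0 else u i - u (i - 1) := by
  rw [expand_prime_pSeries, sub_eq_add_neg, pSeries_neg, pSeries_add]
  congr 1
  ext i
  rcases eq_or_ne i 0 with rfl | h
  · simp
  · simp [h, sub_eq_add_neg]

end PSeries

/-! ### Integrality of the Artin-Hasse exponential. -/

section Integrality

variable (p : ℕ) [hp : Fact p.Prime]

theorem constantCoeff_exp_subst {K : Type*} [Field K] [CharZero K] {f : PowerSeries K}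
    (hf : constantCoeff f = 0) : constantCoeff ((PowerSeries.exp K).subst f) = 1 := by
  have hs : HasSubst f := HasSubst.of_constantCoeff_zero' hf
  have h0 : constantCoeff ((PowerSeries.exp K - 1).subst f) = 0 :=
    constantCoeff_subst_eq_zero hf _ (by simp)
  have h1 : (1 : PowerSeries K).subst f = (1 : PowerSeries K) := by
    rw [← coe_substAlgHom hs, map_one]
  rw [subst_sub hs, h1, map_sub, sub_eq_zero] at h0
  simpa using h0

theorem hasLogDeriv_exp_subst {K : Type*} [Field K] [CharZero K] {f : PowerSeries K}
    (hf : constantCoeff f = 0) :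
    HasLogDeriv ((PowerSeries.exp K).subst f) (X * derivative K f) := by
  refine ⟨constantCoeff_exp_subst hf, ?_⟩
  rw [derivative_subst (HasSubst.of_constantCoeff_zero' hf), derivative_exp]
  ring

/-- The logarithmic derivative of the Artin-Hasse exponential is `∑ i, t ^ (p ^ i)`. -/
theorem hasLogDeriv_artinHasse (K : Type*) [Field K] [CharZero K] :
    HasLogDeriv (artinHasse p K) (pSeries p fun _ => 1) := by
  have h0 : (p : K) ≠ 0 := Nat.cast_ne_zero.2 hp.out.ne_zero
  have h1 : constantCoeff (logSeries p K) = 0 := constantCoeff_pSeries p fun i => ((p : K) ^ i)⁻¹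
  rw [artinHasse]
  convert hasLogDeriv_exp_subst h1 using 1
  rw [logSeries_eq_pSeries]
  refine (ext_pSeries (A := K) p (fun i => ?_) fun k hk => ?_).symm
  · rw [coeff_X_mul_derivative, coeff_pow_pSeries]
    push_cast
    exact mul_inv_cancel₀ (pow_ne_zero i h0)
  · rw [coeff_X_mul_derivative, coeff_pSeries_of_ne p _ hk, mul_zero]

/-- In the logarithmic derivatives, `p ∑ t^(p^i)` and `p ∑ t^(p^(i+1))` differ by the single term `p
t`, that of `exp (p t)`. This is the input to Dwork's integrality argument. -/
theorem artinHasse_pow_prime (K : Type*) [Field K] [CharZero K] :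
    artinHasse p K ^ p = PowerSeries.expand p hp.out.ne_zero (artinHasse p K) *
      PowerSeries.rescale (p : K) (PowerSeries.exp K) := by
  have hexp : HasLogDeriv (PowerSeries.exp K) X := ⟨constantCoeff_exp, by
    rw [derivative_exp, mul_comm]⟩
  refine ((hasLogDeriv_artinHasse p K).pow p).unique ?_
  convert ((hasLogDeriv_artinHasse p K).expand p hp.out.ne_zero).mul (hexp.rescale (p : K)) using 1
  have h := pSeries_sub_expand p (fun _ => (1 : K)) hp.out.ne_zero
  have hX : (pSeries p fun i => if i = 0 then (1 : K) else 1 - 1) = X := by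
    refine (ext_pSeries p (fun i => ?_) fun k hk => ?_).symm
    · rw [coeff_X]
      rcases eq_or_ne i 0 with rfl | hi
      · simp
      · rw [if_neg (Nat.one_lt_pow hi hp.out.one_lt).ne', if_neg hi, sub_self]
    · rw [coeff_X, if_neg (by simpa using hk 0)]
  rw [hX] at h
  rw [rescale_X, map_natCast]
  linear_combination (p : PowerSeries K) * h

/-- The strict inequality `v_p(k!) < k` makes `exp (p t)` congruent to `1` modulo `p`, not merely
integral. -/
theorem norm_prime_pow_div_factorial_lt {k : ℕ} (hk : k ≠ 0) :
    ‖(p : ℚ_[p]) ^ k * (k.factorial : ℚ_[p])⁻¹‖ < 1 := by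
  have hf : (k.factorial : ℚ_[p]) ≠ 0 := Nat.cast_ne_zero.2 k.factorial_ne_zero
  have h1 : ‖(p : ℚ_[p]) ^ k‖ < ‖(k.factorial : ℚ_[p])‖ := by
    rw [Padic.norm_p_pow, Padic.norm_eq_zpow_neg_valuation hf, Padic.valuation_natCast]
    refine zpow_lt_zpow_right₀ (by exact_mod_cast hp.out.one_lt) ?_
    have := padicValNat_factorial_lt_of_ne_zero p hk
    omega
  rw [norm_mul, norm_inv, ← div_eq_mul_inv]
  exact (div_lt_one (norm_pos_iff.2 hf)).2 h1

theorem coeff_rescale_exp (k : ℕ) :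
    coeff k (PowerSeries.rescale (p : ℚ_[p]) (PowerSeries.exp ℚ_[p])) =
      (p : ℚ_[p]) ^ k * (k.factorial : ℚ_[p])⁻¹ := by
  rw [coeff_rescale, coeff_exp]
  simp

theorem exists_algebraMap_eq_of_norm_le_one {x : ℚ_[p]} (h : ‖x‖ ≤ 1) :
    ∃ y : ℤ_[p], algebraMap ℤ_[p] ℚ_[p] y = x := ⟨⟨x, h⟩, rfl⟩

theorem exists_map_eq_rescale_exp :
    ∃ g : PowerSeries ℤ_[p], PowerSeries.map (algebraMap ℤ_[p] ℚ_[p]) g =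
        PowerSeries.rescale (p : ℚ_[p]) (PowerSeries.exp ℚ_[p]) ∧
      PowerSeries.map PadicInt.toZMod g = 1 := by
  have h (k : ℕ) : ‖(p : ℚ_[p]) ^ k * (k.factorial : ℚ_[p])⁻¹‖ ≤ 1 := by
    rcases eq_or_ne k 0 with rfl | hk
    · simp
    · exact (norm_prime_pow_div_factorial_lt p hk).le
  choose y hy using fun k => exists_algebraMap_eq_of_norm_le_one p (h k)
  refine ⟨PowerSeries.mk y, ?_, ?_⟩
  · ext k
    rw [coeff_rescale_exp, coeff_map, coeff_mk, hy]
  · ext k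
    rw [coeff_map, coeff_mk, coeff_one]
    split_ifs with hk
    · subst hk
      have h1 : y 0 = 1 := by
        apply FaithfulSMul.algebraMap_injective ℤ_[p] ℚ_[p]
        rw [hy, map_one]
        simp
      rw [h1, map_one]
    · rw [← RingHom.mem_ker, PadicInt.ker_toZMod, IsLocalRing.mem_maximalIdeal,
        PadicInt.mem_nonunits, PadicInt.norm_def]
      have := norm_prime_pow_div_factorial_lt p hk
      rwa [← hy] at this

theorem map_toZMod_pow_prime (g : PowerSeries ℤ_[p]) :
    PowerSeries.map PadicInt.toZMod (g ^ p) =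
      PowerSeries.map PadicInt.toZMod (PowerSeries.expand p hp.out.ne_zero g) := by
  have h := MvPowerSeries.map_frobenius_expand p hp.out.ne_zero
    (f := PowerSeries.map (PadicInt.toZMod (p := p)) g)
  have hid : frobenius (ZMod p) p = RingHom.id _ := ZMod.frobenius_zmod p
  rw [hid, MvPowerSeries.map_id] at h
  rw [map_pow, map_expand]
  exact h.symm

/-- First-order expansion: the quadratic and higher terms are divisible by `X ^ (2 * k)`, beyond
degree `k` as `k ≠ 0`. -/
theorem coeff_add_X_pow_mul_pow {A : Type*} [CommRing A] (f r : PowerSeries A) {k : ℕ} (hk : k ≠ 0)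
    (hf : constantCoeff f = 1) (n : ℕ) :
    coeff k ((f + X ^ k * r) ^ n) = coeff k (f ^ n) + n * constantCoeff r := by
  obtain ⟨c, hc⟩ := Polynomial.powAddExpansion f (X ^ k * r) n
  rw [hc, map_add, map_add]
  have h1 : coeff k (c * (X ^ k * r) ^ 2) = 0 := by
    rw [show c * (X ^ k * r) ^ 2 = X ^ (k + k) * (c * r ^ 2) by ring, coeff_X_pow_mul',
      if_neg (by omega)]
  have h2 : coeff k ((n : PowerSeries A) * f ^ (n - 1) * (X ^ k * r)) = n * constantCoeff r := by
    rw [show (n : PowerSeries A) * f ^ (n - 1) * (X ^ k * r) =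
      X ^ k * ((n : PowerSeries A) * f ^ (n - 1) * r) by ring,
      coeff_X_pow_mul', if_pos le_rfl, Nat.sub_self, coeff_zero_eq_constantCoeff_apply]
    simp [hf]
  rw [h1, h2, add_zero]

/-- The coefficients of the Artin-Hasse exponential are `p`-integral. -/
theorem norm_coeff_artinHasse_le_one (k : ℕ) : ‖coeff k (artinHasse p ℚ_[p])‖ ≤ 1 := by
  classical
  induction k using Nat.strong_induction_on with
  | _ k ih =>
  set f := artinHasse p ℚ_[p] with hf
  have hf0 : constantCoeff f = 1 := (hasLogDeriv_artinHasse p ℚ_[p]).1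
  rcases eq_or_ne k 0 with rfl | hk
  · simp [hf0]
  choose y hy using fun i hi => exists_algebraMap_eq_of_norm_le_one p (ih i hi)
  -- The part of `f` in degrees below `k`, which is integral by induction.
  let g : PowerSeries ℤ_[p] := PowerSeries.mk fun i => if h : i < k then y i h else 0
  let G : PowerSeries ℚ_[p] := PowerSeries.map (algebraMap ℤ_[p] ℚ_[p]) g
  have hG {i : ℕ} (hi : i < k) : coeff i G = coeff i f := by
    rw [coeff_map, coeff_mk, dif_pos hi, hy]
  have hGk : coeff k G = 0 := by
    rw [coeff_map, coeff_mk, dif_neg (lt_irrefl k), map_zero]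
  have hG0 : constantCoeff G = 1 := by
    rw [← coeff_zero_eq_constantCoeff_apply, hG (Nat.pos_of_ne_zero hk),
      coeff_zero_eq_constantCoeff_apply, hf0]
  obtain ⟨r, hr⟩ : X ^ k ∣ f - G := by
    rw [X_pow_dvd_iff]
    intro i hi
    rw [map_sub, hG hi, sub_self]
  have hr' : f = G + X ^ k * r := by rw [← hr]; ring
  have hr0 : constantCoeff r = coeff k f := by
    rw [hr', map_add, hGk, coeff_X_pow_mul', if_pos le_rfl, Nat.sub_self, zero_add,
      coeff_zero_eq_constantCoeff_apply]
  obtain ⟨u, hu, hu1⟩ := exists_map_eq_rescale_exp p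
  -- Dwork's congruence `g(t)^p ≡ g(t^p)` modulo `p`, where also `exp (p t) ≡ 1`.
  have hmod : PowerSeries.map PadicInt.toZMod
      (PowerSeries.expand p hp.out.ne_zero g * u - g ^ p) = 0 := by
    rw [map_sub, map_toZMod_pow_prime, map_mul, hu1, mul_one, sub_self]
  have hc := congrArg (coeff k) hmod
  rw [coeff_map, map_zero, ← RingHom.mem_ker, PadicInt.ker_toZMod,
    PadicInt.maximalIdeal_eq_span_p, Ideal.mem_span_singleton] at hc
  obtain ⟨c, hc⟩ := hc
  -- In degree `k > 0`, `f(t^p)` contributes only coefficients of `f` of index at most `k / p < k`,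
  -- so `f` may be replaced by `G`.
  have key : coeff k (f ^ p) = coeff k (PowerSeries.expand p hp.out.ne_zero G *
      PowerSeries.map (algebraMap ℤ_[p] ℚ_[p]) u) := by
    rw [hf, artinHasse_pow_prime, hu, coeff_mul, coeff_mul]
    refine Finset.sum_congr rfl fun x hx => ?_
    congr 1
    rw [coeff_expand, coeff_expand]
    split_ifs
    · refine (hG ?_).symm
      have := Finset.HasAntidiagonal.mem_antidiagonal.1 hx
      rcases Nat.eq_zero_or_pos x.1 with h0 | h0
      · rw [h0, Nat.zero_div]; omega
      · exact (Nat.div_lt_self h0 hp.out.one_lt).trans_le (by omega)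
    · rfl
  have hc' := congrArg (algebraMap ℤ_[p] ℚ_[p]) hc
  -- The left side collapses to `p` times the coefficient of `f` in degree `k`; cancelling `p`
  -- identifies that coefficient with the integer `c`.
  rw [← coeff_map, map_sub, map_mul, map_pow, map_expand, map_sub, ← key, hr',
    coeff_add_X_pow_mul_pow G r hk hG0, hr0, add_sub_cancel_left, map_mul, map_natCast] at hc'
  rw [mul_left_cancel₀ (Nat.cast_ne_zero.2 hp.out.ne_zero) hc']
  exact c.2

end Integrality

/-! ### The series `E_z` and `F_z` over arbitrary `ℤ_p`-algebras. -/

section Series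

variable (p : ℕ) [hp : Fact p.Prime]

/-- The Artin-Hasse exponential as a series over `ℤ_p`. -/
def artinHasseInt : PowerSeries ℤ_[p] :=
  PowerSeries.mk fun k =>
    (exists_algebraMap_eq_of_norm_le_one p (norm_coeff_artinHasse_le_one p k)).choose

theorem map_artinHasseInt_padic :
    PowerSeries.map (algebraMap ℤ_[p] ℚ_[p]) (artinHasseInt p) = artinHasse p ℚ_[p] := by
  ext k
  rw [coeff_map, artinHasseInt, coeff_mk]
  exact (exists_algebraMap_eq_of_norm_le_one p (norm_coeff_artinHasse_le_one p k)).choose_spec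

theorem hasLogDeriv_artinHasseInt : HasLogDeriv (artinHasseInt p) (pSeries p fun _ => 1) := by
  refine HasLogDeriv.of_map (φ := algebraMap ℤ_[p] ℚ_[p]) Subtype.val_injective ?_
  rw [map_artinHasseInt_padic, map_pSeries]
  simpa using hasLogDeriv_artinHasse p ℚ_[p]

variable (A : Type*) [CommRing A] [Algebra ℤ_[p] A]

/-- The Artin-Hasse exponential over a `ℤ_p`-algebra. -/
def AH : PowerSeries A := PowerSeries.map (algebraMap ℤ_[p] A) (artinHasseInt p)

/-- The inverse of the Artin-Hasse exponential over a `ℤ_p`-algebra. -/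
def AHInv : PowerSeries A :=
  PowerSeries.map (algebraMap ℤ_[p] A) (invOfUnit (artinHasseInt p) 1)

theorem AH_mul_AHInv : AH p A * AHInv p A = 1 := by
  rw [AH, AHInv, ← map_mul, mul_invOfUnit _ _ (by simp [(hasLogDeriv_artinHasseInt p).1]), map_one]

theorem hasLogDeriv_AH : HasLogDeriv (AH p A) (pSeries p fun _ => 1) := by
  have h := (hasLogDeriv_artinHasseInt p).map (algebraMap ℤ_[p] A)
  simp only [map_pSeries, map_one] at h
  exact h

theorem AH_eq_artinHasse (K : Type*) [Field K] [CharZero K] [Algebra ℤ_[p] K] :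
    AH p K = artinHasse p K :=
  (hasLogDeriv_AH p K).unique (hasLogDeriv_artinHasse p K)

variable {A}

/-- The series `E_p(z t) / E_p(t)` over a `ℤ_p`-algebra. -/
def EInt (z : A) : PowerSeries A := PowerSeries.rescale z (AH p A) * AHInv p A

/-- The series `E_p(t) / E_p(z t)` over a `ℤ_p`-algebra. -/
def EIntInv (z : A) : PowerSeries A := PowerSeries.rescale z (AHInv p A) * AH p A

/-- The series `E_z(t) / E_z(t ^ p)`, where `E_z(t) = E_p(z t) / E_p(t)`,
over a `ℤ_p`-algebra. -/
def FInt (z : A) : PowerSeries A :=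
  EInt p z * PowerSeries.expand p hp.out.ne_zero (EIntInv p z)

theorem EInt_mul_EIntInv (z : A) : EInt p z * EIntInv p z = 1 := by
  have h := congrArg (PowerSeries.rescale z) (AH_mul_AHInv p A)
  rw [map_mul, map_one] at h
  rw [EInt, EIntInv]
  linear_combination AH p A * AHInv p A * h + AH_mul_AHInv p A

theorem hasLogDeriv_EInt (z : A) : HasLogDeriv (EInt p z) (pSeries p fun i => z ^ p ^ i - 1) := by
  have h := hasLogDeriv_AH p A
  rw [EInt]
  convert (h.rescale z).mul (h.of_mul_eq_one (AH_mul_AHInv p A)) using 1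
  rw [rescale_pSeries, pSeries_neg, pSeries_add]
  congr 1
  ext i
  simp [sub_eq_add_neg]

theorem FInt_mul_expand_EInt (z : A) :
    FInt p z * PowerSeries.expand p hp.out.ne_zero (EInt p z) = EInt p z := by
  rw [FInt, mul_assoc, ← map_mul, mul_comm (EIntInv p z), EInt_mul_EIntInv, map_one, mul_one]

variable {B : Type*} [CommRing B] [Algebra ℤ_[p] B]

theorem map_AH (φ : A →ₐ[ℤ_[p]] B) : PowerSeries.map (φ : A →+* B) (AH p A) = AH p B := by
  rw [AH, AH]
  ext k
  simp [coeff_map]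

theorem map_AHInv (φ : A →ₐ[ℤ_[p]] B) : PowerSeries.map (φ : A →+* B) (AHInv p A) = AHInv p B := by
  rw [AHInv, AHInv]
  ext k
  simp [coeff_map]

theorem map_rescale {A B : Type*} [CommRing A] [CommRing B] (φ : A →+* B) (z : A)
    (f : PowerSeries A) : PowerSeries.map φ (PowerSeries.rescale z f) =
      PowerSeries.rescale (φ z) (PowerSeries.map φ f) := by
  ext k
  simp [coeff_map, coeff_rescale]

theorem map_EInt (φ : A →ₐ[ℤ_[p]] B) (z : A) :
    PowerSeries.map (φ : A →+* B) (EInt p z) = EInt p (φ z) := by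
  rw [EInt, map_mul, map_rescale, map_AH, map_AHInv]
  rfl

theorem map_EIntInv (φ : A →ₐ[ℤ_[p]] B) (z : A) :
    PowerSeries.map (φ : A →+* B) (EIntInv p z) = EIntInv p (φ z) := by
  rw [EIntInv, map_mul, map_rescale, map_AH, map_AHInv]
  rfl

theorem map_FInt (φ : A →ₐ[ℤ_[p]] B) (z : A) :
    PowerSeries.map (φ : A →+* B) (FInt p z) = FInt p (φ z) := by
  rw [FInt, map_mul, map_EInt, map_expand, map_EIntInv]
  rfl

theorem E_eq_EInt (z : PadicAlgCl p) : E p z = EInt p z := by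
  have h := AH_mul_AHInv p (PadicAlgCl p)
  have h1 : constantCoeff (artinHasse p (PadicAlgCl p)) ≠ 0 := by
    rw [(hasLogDeriv_artinHasse p (PadicAlgCl p)).1]
    exact one_ne_zero
  rw [E, EInt, AH_eq_artinHasse]
  congr 1
  rw [AH_eq_artinHasse] at h
  rw [PowerSeries.inv_eq_iff_mul_eq_one h1, mul_comm, h]

theorem F_eq_FInt (z : PadicAlgCl p) : F p z = FInt p z := by
  have h1 : constantCoeff (PowerSeries.expand p hp.out.ne_zero (EInt p z)) ≠ 0 := by
    rw [constantCoeff_expand, (hasLogDeriv_EInt p z).1]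
    exact one_ne_zero
  rw [F, FInt, E_eq_EInt]
  congr 1
  rw [PowerSeries.inv_eq_iff_mul_eq_one h1, ← map_mul, mul_comm, EInt_mul_EIntInv, map_one]

end Series

/-! ### Evaluation of power series at `1`. -/

section CoeffSum

/-- A normed ring with ultrametric distance is a nonarchimedean ring. -/
theorem nonarchimedeanRing_of_isUltrametricDist (A : Type*) [NormedCommRing A]
    [IsUltrametricDist A] : NonarchimedeanRing A where
  is_nonarchimedean := NonarchimedeanAddGroup.is_nonarchimedean

/-- A linearly topologized commutative ring is a nonarchimedean ring. -/
theorem nonarchimedeanRing_of_isLinearTopology (A : Type*) [CommRing A] [TopologicalSpace A]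
    [IsTopologicalRing A] [IsLinearTopology A A] : NonarchimedeanRing A where
  is_nonarchimedean U hU := by
    obtain ⟨I, ⟨hI, hIU⟩⟩ := (IsLinearTopology.hasBasis_open_ideal (R := A)).mem_iff.1 hU
    exact ⟨⟨I.toAddSubgroup, hI⟩, hIU⟩

/-- The coefficients of `f` sum to `s`. -/
def HasCoeffSum {A : Type*} [CommRing A] [TopologicalSpace A] (f : PowerSeries A) (s : A) : Prop :=
  HasSum (fun k => coeff k f) s

namespace HasCoeffSum

variable {A : Type*} [CommRing A]

section Topological

variable [TopologicalSpace A]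

theorem unique [T2Space A] {f : PowerSeries A} {s t : A} (hf : HasCoeffSum f s)
    (hg : HasCoeffSum f t) : s = t := HasSum.unique hf hg

theorem C (a : A) : HasCoeffSum (PowerSeries.C a) a := by
  have h : HasSum (fun k => if k = 0 then a else 0) a := hasSum_ite_eq 0 a
  simpa only [HasCoeffSum, coeff_C] using h

theorem one : HasCoeffSum (1 : PowerSeries A) 1 := by
  simpa using C (1 : A)

theorem X : HasCoeffSum (X : PowerSeries A) 1 := by
  have h : HasSum (fun k => if k = 1 then (1 : A) else 0) 1 := hasSum_ite_eq 1 1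
  simpa only [HasCoeffSum, coeff_X] using h

theorem expand {f : PowerSeries A} {s : A} (hf : HasCoeffSum f s) (q : ℕ) (hq : q ≠ 0) :
    HasCoeffSum (PowerSeries.expand q hq f) s := by
  have hi : Function.Injective (q * ·) := mul_right_injective₀ hq
  refine (hi.hasSum_iff (fun x hx => ?_)).1 ?_
  · refine coeff_expand_of_not_dvd q hq f fun ⟨c, hc⟩ => hx ⟨c, hc.symm⟩
  · convert (show HasSum _ _ from hf) using 2 with k
    exact coeff_expand_mul q hq f k

variable [IsTopologicalRing A]

theorem add {f g : PowerSeries A} {s t : A} (hf : HasCoeffSum f s) (hg : HasCoeffSum g t) :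
    HasCoeffSum (f + g) (s + t) := by
  simpa only [HasCoeffSum, map_add] using HasSum.add hf hg

theorem sub {f g : PowerSeries A} {s t : A} (hf : HasCoeffSum f s) (hg : HasCoeffSum g t) :
    HasCoeffSum (f - g) (s - t) := by
  simpa only [HasCoeffSum, map_sub] using HasSum.sub hf hg

theorem nsmul {f : PowerSeries A} {s : A} (hf : HasCoeffSum f s) (n : ℕ) :
    HasCoeffSum (n • f) (n • s) := by
  have h : HasSum (fun k => (n : A) * coeff k f) (n * s) := HasSum.mul_left (n : A) hf
  simpa only [HasCoeffSum, map_nsmul, ← nsmul_eq_mul] using h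

theorem sum {ι : Type*} (I : Finset ι) {f : ι → PowerSeries A} {s : ι → A}
    (h : ∀ i ∈ I, HasCoeffSum (f i) (s i)) : HasCoeffSum (∑ i ∈ I, f i) (∑ i ∈ I, s i) := by
  simpa only [HasCoeffSum, map_sum] using hasSum_sum h

end Topological

section Uniform

variable [UniformSpace A] [IsUniformAddGroup A] [NonarchimedeanRing A]

/-- In a nonarchimedean ring the double family of products is summable without any absolute
convergence, so it can be regrouped along antidiagonals. -/
theorem mul {f g : PowerSeries A} {s t : A} (hf : HasCoeffSum f s) (hg : HasCoeffSum g t) :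
    HasCoeffSum (f * g) (s * t) := by
  have h := HasSum.mul_of_nonarchimedean hf hg
  have h1 := (Finset.HasAntidiagonal.sigmaAntidiagonalEquivProd.hasSum_iff).2 h
  simp only [HasCoeffSum, coeff_mul]
  refine h1.sigma fun n => ?_
  have h2 := hasSum_fintype fun c : Finset.HasAntidiagonal.antidiagonal n =>
    coeff (c : ℕ × ℕ).1 f * coeff (c : ℕ × ℕ).2 g
  rw [Finset.sum_coe_sort (Finset.HasAntidiagonal.antidiagonal n)
    fun c : ℕ × ℕ => coeff c.1 f * coeff c.2 g] at h2
  exact h2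

theorem prod {ι : Type*} (I : Finset ι) {f : ι → PowerSeries A} {s : ι → A}
    (h : ∀ i ∈ I, HasCoeffSum (f i) (s i)) : HasCoeffSum (∏ i ∈ I, f i) (∏ i ∈ I, s i) := by
  classical
  induction I using Finset.induction_on with
  | empty => simpa using one
  | insert i I hi ih =>
    rw [Finset.prod_insert hi, Finset.prod_insert hi]
    exact (h i (Finset.mem_insert_self i I)).mul
      (ih fun j hj => h j (Finset.mem_insert_of_mem hj))

end Uniform

end HasCoeffSum

end CoeffSum

/-! ### Series in `t` with polynomial coefficients in `X`. -/

section Bivariate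

variable {A : Type*} [CommRing A]

/-- The `j`-th coefficient in `X` of a series in `t` whose coefficients are polynomials in `X`. -/
def polyCoeff (j : ℕ) (f : PowerSeries (Polynomial A)) : PowerSeries A :=
  PowerSeries.mk fun k => (coeff k f).coeff j

theorem coeff_polyCoeff (j k : ℕ) (f : PowerSeries (Polynomial A)) :
    coeff k (polyCoeff j f) = (coeff k f).coeff j := coeff_mk _ _

theorem polyCoeff_sub (j : ℕ) (f g : PowerSeries (Polynomial A)) :
    polyCoeff j (f - g) = polyCoeff j f - polyCoeff j g := by
  ext k; simp [coeff_polyCoeff]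

theorem polyCoeff_mul (j : ℕ) (f g : PowerSeries (Polynomial A)) :
    polyCoeff j (f * g) =
      ∑ x ∈ Finset.HasAntidiagonal.antidiagonal j, polyCoeff x.1 f * polyCoeff x.2 g := by
  ext k
  simp only [coeff_polyCoeff, coeff_mul, map_sum, Polynomial.finsetSum_coeff, Polynomial.coeff_mul]
  exact Finset.sum_comm

theorem polyCoeff_expand (j q : ℕ) (hq : q ≠ 0) (f : PowerSeries (Polynomial A)) :
    polyCoeff j (PowerSeries.expand q hq f) = PowerSeries.expand q hq (polyCoeff j f) := by
  ext k
  rw [coeff_polyCoeff, coeff_expand, coeff_expand]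
  split_ifs
  · rw [coeff_polyCoeff]
  · simp

/-- The operator `(1 + X) d / dX`, applied to the coefficients of a series in `t`. -/
def eulerX (f : PowerSeries (Polynomial A)) : PowerSeries (Polynomial A) :=
  PowerSeries.mk fun k => (1 + Polynomial.X) * Polynomial.derivative (coeff k f)

theorem coeff_eulerX (k : ℕ) (f : PowerSeries (Polynomial A)) :
    coeff k (eulerX f) = (1 + Polynomial.X) * Polynomial.derivative (coeff k f) := coeff_mk _ _

theorem eulerX_mul (f g : PowerSeries (Polynomial A)) :
    eulerX (f * g) = eulerX f * g + f * eulerX g := by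
  ext1 k
  simp only [coeff_eulerX, coeff_mul, map_add, Polynomial.derivative_sum, Finset.mul_sum,
    Polynomial.derivative_mul, ← Finset.sum_add_distrib]
  refine Finset.sum_congr rfl fun x _ => by ring

theorem eulerX_expand (q : ℕ) (hq : q ≠ 0) (f : PowerSeries (Polynomial A)) :
    eulerX (PowerSeries.expand q hq f) = PowerSeries.expand q hq (eulerX f) := by
  ext1 k
  rw [coeff_eulerX, coeff_expand, coeff_expand]
  split_ifs
  · rw [coeff_eulerX]
  · simp

theorem eulerX_map_C (f : PowerSeries A) : eulerX (PowerSeries.map Polynomial.C f) = 0 := by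
  ext1 k
  simp [coeff_eulerX, coeff_map]

theorem eulerX_rescale_map_C (f : PowerSeries A) :
    eulerX (PowerSeries.rescale (1 + Polynomial.X) (PowerSeries.map Polynomial.C f)) =
      X * derivative _
        (PowerSeries.rescale (1 + Polynomial.X : Polynomial A) (PowerSeries.map Polynomial.C f)) := by
  ext1 k
  rw [coeff_eulerX, coeff_X_mul_derivative, coeff_rescale, coeff_map, Polynomial.derivative_mul,
    Polynomial.derivative_C, mul_zero, add_zero, Polynomial.derivative_pow]
  rcases k with _ | k
  · simp
  · simp only [Nat.cast_add, Nat.cast_one, Nat.add_sub_cancel,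
      Polynomial.derivative_one, Polynomial.derivative_X, map_add, map_one, Polynomial.C_eq_natCast]
    ring

theorem polyCoeff_eulerX (j : ℕ) (f : PowerSeries (Polynomial A)) :
    polyCoeff j (eulerX f) = (j + 1) • polyCoeff (j + 1) f + j • polyCoeff j f := by
  ext k
  rw [coeff_polyCoeff, coeff_eulerX, add_mul, one_mul, Polynomial.coeff_add,
    Polynomial.coeff_derivative, map_add, map_nsmul, map_nsmul, coeff_polyCoeff, coeff_polyCoeff]
  rcases j with _ | j
  · simp
  · rw [Polynomial.coeff_X_mul, Polynomial.coeff_derivative]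
    simp only [nsmul_eq_mul]
    push_cast
    ring

end Bivariate

/-! ### The value `F_z(1) = z`, via the universal case `z = 1 + X`. -/

section UniversalF

variable (p : ℕ) [hp : Fact p.Prime]

/-- The series `E_z(t) / E_z(t ^ p)` with `z = 1 + X` an indeterminate. -/
def FUniv : PowerSeries (Polynomial ℤ_[p]) := FInt p (1 + Polynomial.X)

/-- On a function of `(1 + X) t` the operator `(1 + X) d/dX` agrees with `t d/dt`, and it kills the
factors free of `X`. Only the logarithmic derivative of `E_p((1 + X) t)` and its image under `t ↦
t^p` survive. -/
theorem eulerX_FUniv :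
    eulerX (FUniv p) = FUniv p * ((pSeries p fun i => (1 + Polynomial.X) ^ p ^ i) -
      PowerSeries.expand p hp.out.ne_zero (pSeries p fun i => (1 + Polynomial.X) ^ p ^ i)) := by
  have hL := hasLogDeriv_AH p (Polynomial ℤ_[p])
  have hu := (hL.rescale (1 + Polynomial.X)).2
  have hv := ((hL.of_mul_eq_one (AH_mul_AHInv p _)).rescale (1 + Polynomial.X)).2
  rw [map_neg] at hv
  simp only [rescale_pSeries, mul_one] at hu hv
  have hu' : eulerX (PowerSeries.rescale (1 + Polynomial.X) (AH p (Polynomial ℤ_[p]))) = _ :=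
    (eulerX_rescale_map_C _).trans hu
  have hv' : eulerX (PowerSeries.rescale (1 + Polynomial.X) (AHInv p (Polynomial ℤ_[p]))) = _ :=
    (eulerX_rescale_map_C _).trans hv
  have ha : eulerX (AH p (Polynomial ℤ_[p])) = 0 := eulerX_map_C _
  have hb : eulerX (AHInv p (Polynomial ℤ_[p])) = 0 := eulerX_map_C _
  rw [FUniv, FInt, EInt, EIntInv, eulerX_mul, eulerX_mul, eulerX_expand, eulerX_mul, hu', hv', ha,
    hb]
  simp only [map_mul, map_neg, mul_zero, add_zero]
  ring

theorem polyCoeff_pSeries (s : ℕ) :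
    polyCoeff s (pSeries p fun i => (1 + Polynomial.X : Polynomial ℤ_[p]) ^ p ^ i) =
      pSeries p fun i => ((p ^ i).choose s : ℤ_[p]) := by
  refine ext_pSeries p (fun i => ?_) fun k hk => ?_
  · rw [coeff_polyCoeff, coeff_pow_pSeries, Polynomial.coeff_one_add_X_pow]
  · rw [coeff_polyCoeff, coeff_pSeries_of_ne p _ hk, Polynomial.coeff_zero]

theorem polyCoeff_zero_FUniv : polyCoeff 0 (FUniv p) = 1 := by
  have h : polyCoeff 0 (FUniv p) = FInt p (1 : ℤ_[p]) := by
    have := map_FInt p (Polynomial.aeval (0 : ℤ_[p])) (1 + Polynomial.X)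
    rw [map_add, map_one, Polynomial.aeval_X, add_zero] at this
    rw [← this]
    ext k
    rw [coeff_polyCoeff, coeff_map, Polynomial.coeff_zero_eq_aeval_zero]
    rfl
  have h1 : EInt p (1 : ℤ_[p]) = 1 := by
    rw [EInt, rescale_one, RingHom.id_apply, AH_mul_AHInv]
  have h2 := FInt_mul_expand_EInt p (1 : ℤ_[p])
  rw [h1, map_one, mul_one] at h2
  rw [h, h2]

theorem succ_nsmul_polyCoeff_FUniv (j : ℕ) :
    (j + 1) • polyCoeff (j + 1) (FUniv p) + j • polyCoeff j (FUniv p) =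
      ∑ x ∈ Finset.HasAntidiagonal.antidiagonal j, polyCoeff x.1 (FUniv p) *
        ((pSeries p fun i => ((p ^ i).choose x.2 : ℤ_[p])) -
          PowerSeries.expand p hp.out.ne_zero (pSeries p fun i => ((p ^ i).choose x.2 : ℤ_[p]))) := by
  rw [← polyCoeff_eulerX, eulerX_FUniv, polyCoeff_mul]
  simp only [polyCoeff_sub, polyCoeff_expand, polyCoeff_pSeries]

/-- Writing the lower index as `s + 1`, the identity `(s + 1) C(p^i, s + 1) = p^i C(p^i - 1, s)`
bounds the norm by `|p|^i / |s + 1|`. -/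
theorem tendsto_choose_prime_pow {s : ℕ} (hs : s ≠ 0) :
    Tendsto (fun i => ((p ^ i).choose s : ℤ_[p])) atTop (𝓝 0) := by
  obtain ⟨s, rfl⟩ := Nat.exists_eq_succ_of_ne_zero hs
  have hs0 : (0 : ℝ) < ‖((s + 1 : ℕ) : ℤ_[p])‖ :=
    norm_pos_iff.2 (Nat.cast_ne_zero.2 (Nat.succ_ne_zero s))
  have hlim : Tendsto (fun i => ‖(p : ℤ_[p])‖ ^ i / ‖((s + 1 : ℕ) : ℤ_[p])‖) atTop (𝓝 0) := by
    rw [← zero_div]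
    exact (tendsto_pow_atTop_nhds_zero_of_lt_one (norm_nonneg _)
      (PadicInt.norm_lt_one_iff_dvd _ |>.2 dvd_rfl)).div_const _
  refine squeeze_zero_norm (fun i => ?_) hlim
  rw [le_div_iff₀ hs0, ← norm_mul, ← norm_pow]
  have h := Nat.add_one_mul_choose_eq (p ^ i - 1) s
  rw [Nat.sub_add_cancel (Nat.one_le_pow _ _ hp.out.pos)] at h
  rw [← Nat.cast_mul, ← h, Nat.cast_mul, norm_mul, Nat.cast_pow]
  exact mul_le_of_le_one_right (norm_nonneg _) (PadicInt.norm_le_one _)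

theorem summable_coeff_pSeries {A : Type*} [NormedCommRing A] [IsUltrametricDist A]
    [CompleteSpace A] {u : ℕ → A} (hu : Tendsto u atTop (𝓝 0)) :
    ∃ s, HasCoeffSum (pSeries p u) s := by
  rw [← Nat.cofinite_eq_atTop] at hu
  have h1 := NonarchimedeanAddGroup.summable_of_tendsto_cofinite_zero hu
  refine ⟨∑' i, u i, ((Nat.pow_right_injective hp.out.two_le).hasSum_iff fun x hx => ?_).1 ?_⟩
  · exact coeff_pSeries_of_ne p u fun i hi => hx ⟨i, hi.symm⟩
  · exact h1.hasSum.congr_fun fun i => coeff_pow_pSeries p u i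

/-- For `s ≠ 0` the series is summable and has the same sum after `t ↦ t^p`, so the difference sums
to `0`. For `s = 0` summability fails, but the difference telescopes to `t` before evaluation. -/
theorem hasCoeffSum_pSeries_choose_sub_expand (s : ℕ) :
    HasCoeffSum ((pSeries p fun i => ((p ^ i).choose s : ℤ_[p])) -
      PowerSeries.expand p hp.out.ne_zero (pSeries p fun i => ((p ^ i).choose s : ℤ_[p])))
      (if s = 0 then 1 else 0) := by
  split_ifs with hs
  · subst hs
    have h : (pSeries p fun i => if i = 0 then ((p ^ 0).choose 0 : ℤ_[p]) else
        ((p ^ i).choose 0 : ℤ_[p]) - ((p ^ (i - 1)).choose 0 : ℤ_[p])) = X := by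
      refine (ext_pSeries p (fun i => ?_) fun k hk => ?_).symm
      · rw [coeff_X]
        rcases eq_or_ne i 0 with rfl | hi
        · simp
        · rw [if_neg (Nat.one_lt_pow hi hp.out.one_lt).ne', if_neg hi]
          simp
      · rw [coeff_X, if_neg (by simpa using hk 0)]
    rw [pSeries_sub_expand, h]
    exact HasCoeffSum.X
  · obtain ⟨t, ht⟩ := summable_coeff_pSeries p (tendsto_choose_prime_pow p hs)
    simpa using ht.sub (ht.expand p hp.out.ne_zero)

/-- The integer `j + 1` need not be a unit of `ℤ_p`, so the division takes place in `ℚ_p`, whose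
topology induces that of `ℤ_p`. -/
theorem HasCoeffSum.of_succ_nsmul {f : PowerSeries ℤ_[p]} {s : ℤ_[p]} {j : ℕ}
    (h : HasCoeffSum ((j + 1) • f) ((j + 1) • s)) : HasCoeffSum f s := by
  have hi : Topology.IsInducing (PadicInt.Coe.ringHom (p := p)) := ⟨rfl⟩
  have h1 := (hi.hasSum_iff _ _).2 h
  refine (hi.hasSum_iff _ _).1 ?_
  refine (hasSum_mul_left_iff (a₂ := ((j + 1 : ℕ) : ℚ_[p]))
    (Nat.cast_ne_zero.2 (Nat.succ_ne_zero j))).1 ?_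
  convert h1 using 2 with k
  · change _ = PadicInt.Coe.ringHom (coeff k ((j + 1) • f))
    rw [map_nsmul (coeff k), map_nsmul, nsmul_eq_mul]
    rfl
  · rw [map_nsmul, nsmul_eq_mul]

/-- The `X`-coefficients of `F_{1 + X}(t)`, evaluated at `t = 1`, are those of `1 + X`. -/
theorem hasCoeffSum_polyCoeff_FUniv (j : ℕ) :
    HasCoeffSum (polyCoeff j (FUniv p)) (if j ≤ 1 then 1 else 0) := by
  have := nonarchimedeanRing_of_isUltrametricDist ℤ_[p]
  induction j using Nat.strong_induction_on with
  | _ j ih =>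
  rcases j with _ | j
  · simpa [polyCoeff_zero_FUniv] using HasCoeffSum.one
  refine HasCoeffSum.of_succ_nsmul p (j := j) ?_
  have h1 := HasCoeffSum.sum (Finset.HasAntidiagonal.antidiagonal j) fun x hx =>
    (ih x.1 (by have := Finset.HasAntidiagonal.mem_antidiagonal.1 hx; omega)).mul
      (hasCoeffSum_pSeries_choose_sub_expand p x.2)
  rw [← succ_nsmul_polyCoeff_FUniv] at h1
  have h2 := h1.sub ((ih j (Nat.lt_succ_self j)).nsmul j)
  rw [add_sub_cancel_right] at h2
  convert h2 using 1
  -- With `c_j` the claimed sums, the recurrence reads `(j + 1) c_{j+1} + j c_j = c_j`, giving `1,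
  -- 1, 0, 0, …`.
  rw [Finset.sum_eq_single (j, 0)]
  · rcases j with _ | _ | j
    · simp
    · simp
    · simp
  · rintro ⟨a, b⟩ hx hne
    have hb : b ≠ 0 := by
      rintro rfl
      have := Finset.HasAntidiagonal.mem_antidiagonal.1 hx
      simp only [add_zero] at this
      exact hne (by rw [this])
    simp [hb]
  · intro h
    exact absurd (Finset.HasAntidiagonal.mem_antidiagonal.2 (by simp)) h

/-- If `z` is close to `1` then the coefficients of `F_z(t)` sum to `z`. -/
theorem hasCoeffSum_FInt {A : Type*} [NormedCommRing A] [IsUltrametricDist A] [CompleteSpace A]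
    [Algebra ℤ_[p] A] (hA : ∀ x : ℤ_[p], ‖algebraMap ℤ_[p] A x‖ ≤ ‖x‖) {z : A}
    (hz : ‖z - 1‖ < 1) : HasCoeffSum (FInt p z) z := by
  have hcont : Continuous (algebraMap ℤ_[p] A) :=
    AddMonoidHomClass.continuous_of_bound (algebraMap ℤ_[p] A) 1 (by simpa using hA)
  set π := z - 1 with hπ
  let c (j k : ℕ) : A := algebraMap ℤ_[p] A ((coeff k (FUniv p)).coeff j) * π ^ j
  have hF (k : ℕ) : coeff k (FInt p z) = Polynomial.aeval π (coeff k (FUniv p)) := by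
    have h := map_FInt p (Polynomial.aeval π) (1 + Polynomial.X)
    rw [map_add, map_one, Polynomial.aeval_X, hπ, add_sub_cancel] at h
    rw [← h, coeff_map]
    rfl
  have hj (j : ℕ) : HasSum (fun k => c j k) (algebraMap ℤ_[p] A (if j ≤ 1 then 1 else 0) * π ^ j) := by
    have h1 := (HasSum.map (hasCoeffSum_polyCoeff_FUniv p j) (algebraMap ℤ_[p] A) hcont).mul_right
      (π ^ j)
    refine h1.congr_fun fun k => ?_
    simp [c, coeff_polyCoeff]
  have hk (k : ℕ) : HasSum (fun j => c j k) (coeff k (FInt p z)) := by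
    rw [hF, Polynomial.aeval_eq_sum_range]
    simp only [Algebra.smul_def]
    refine hasSum_sum_of_ne_finset_zero fun j hj => ?_
    simp only [c]
    rw [Polynomial.coeff_eq_zero_of_natDegree_lt (by simpa using hj), map_zero, zero_mul]
  -- To exchange the two sums, all but finitely many terms must be small: for `j > J` the factor `π
  -- ^ j` suffices, and each of the finitely many remaining `j` has a convergent row.
  have hsum : Summable fun x : ℕ × ℕ => c x.1 x.2 := by
    refine NonarchimedeanAddGroup.summable_of_tendsto_cofinite_zero ?_
    rw [Metric.tendsto_nhds]
    intro ε hε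
    obtain ⟨J, hJ⟩ := exists_pow_lt_of_lt_one hε hz
    have hfin : (⋃ j ∈ Finset.range (J + 1), Prod.mk j '' {k | ¬ dist (c j k) 0 < ε}).Finite := by
      refine Set.Finite.biUnion (Finset.finite_toSet _) fun j _ => Set.Finite.image _ ?_
      exact Filter.eventually_cofinite.1
        (Metric.tendsto_nhds.1 (hj j).summable.tendsto_cofinite_zero ε hε)
    refine hfin.subset ?_
    rintro ⟨j, k⟩ hjk
    simp only [Set.mem_iUnion, Set.mem_image]
    refine ⟨j, ?_, k, hjk, rfl⟩
    by_contra hjJ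
    have hjJ : J + 1 ≤ j := by simpa using hjJ
    refine hjk ?_
    change dist (c j k) 0 < ε
    rw [dist_zero_right]
    calc ‖c j k‖ ≤ ‖algebraMap ℤ_[p] A ((coeff k (FUniv p)).coeff j)‖ * ‖π ^ j‖ := norm_mul_le _ _
      _ ≤ 1 * ‖π‖ ^ j := mul_le_mul ((hA _).trans (PadicInt.norm_le_one _))
          (norm_pow_le' _ (by omega)) (norm_nonneg _) zero_le_one
      _ ≤ 1 * ‖π‖ ^ J := by
          gcongr 1 * ?_
          exact pow_le_pow_of_le_one (norm_nonneg _) hz.le (by omega)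
      _ < ε := by rwa [one_mul]
  have h1 : HasSum (fun j => algebraMap ℤ_[p] A (if j ≤ 1 then 1 else 0) * π ^ j) _ :=
    hsum.hasSum.prod_fiberwise hj
  have h2 : HasSum (fun k => coeff k (FInt p z)) _ :=
    ((Equiv.prodComm ℕ ℕ).hasSum_iff.2 hsum.hasSum).prod_fiberwise hk
  have h3 : HasSum (fun j => algebraMap ℤ_[p] A (if j ≤ 1 then 1 else 0) * π ^ j)
      (∑ j ∈ Finset.range 2, algebraMap ℤ_[p] A (if j ≤ 1 then 1 else 0) * π ^ j) := by
    refine hasSum_sum_of_ne_finset_zero fun j hj => ?_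
    rw [if_neg (by simpa [Nat.lt_succ_iff] using hj), map_zero, zero_mul]
  have h4 : ∑ j ∈ Finset.range 2, algebraMap ℤ_[p] A (if j ≤ 1 then 1 else 0) * π ^ j = z := by
    simp [Finset.sum_range_succ, hπ]
  rw [h1.unique h3, h4] at h2
  exact h2

end UniversalF

/-! ### Series attached to Witt vectors and their additivity. -/

section WittSeries

/-- The Witt vector `(x_0 ^ p, x_1 ^ p, …)`. -/
def wittSigma (p : ℕ) {R : Type*} [CommRing R] (x : WittVector p R) : WittVector p R := WittVector.mk p fun i => x.coeff i ^ p

theorem coeff_wittSigma (p : ℕ) {R : Type*} [CommRing R] (x : WittVector p R) (i : ℕ) : (wittSigma p x).coeff i = x.coeff i ^ p :=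
  rfl

variable (p : ℕ) [hp : Fact p.Prime] {R : Type*} [CommRing R] [Algebra ℤ_[p] R] (ω : R) (n : ℕ)

/-- The product of the series `E_{ω ^ (p ^ i)}(x_i T ^ (p ^ i))` attached to a Witt vector `x`. -/
def ESeries (x : WittVector p R) : PowerSeries R :=
  ∏ i ∈ Finset.range n, PowerSeries.expand (p ^ i) (pow_ne_zero i hp.out.ne_zero)
    (PowerSeries.rescale (x.coeff i) (EInt p (ω ^ p ^ i)))

/-- The product of the series `F_{ω ^ (p ^ i)}(x_i T ^ (p ^ i))` attached to a Witt vector `x`. -/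
def FSeries (x : WittVector p R) : PowerSeries R :=
  ∏ i ∈ Finset.range n, PowerSeries.expand (p ^ i) (pow_ne_zero i hp.out.ne_zero)
    (PowerSeries.rescale (x.coeff i) (FInt p (ω ^ p ^ i)))

variable {ω} (hω : ω ^ p ^ n = 1)

include hω in
/-- The logarithmic derivative of `ESeries` is a linear combination of ghost components. -/
theorem hasLogDeriv_ESeries (x : WittVector p R) :
    HasLogDeriv (ESeries p ω n x)
      (pSeries p fun l => (ω ^ p ^ l - 1) * WittVector.ghostComponent l x) := by
  have h := HasLogDeriv.prod (Finset.range n) fun i _ =>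
    ((hasLogDeriv_EInt p (ω ^ p ^ i)).rescale (x.coeff i)).expand (p ^ i)
      (pow_ne_zero i hp.out.ne_zero)
  simp only [rescale_pSeries, expand_pSeries, natCast_mul_pSeries, sum_pSeries] at h
  rw [ESeries]
  convert h using 3 with l
  rw [WittVector.ghostComponent_apply, aeval_wittPolynomial, Finset.mul_sum]
  -- For `l ≥ n` both sides vanish because `ω ^ p ^ l = 1`, so truncating the product at `n` loses
  -- nothing. For `l < n` the factors with `i > l` do not reach degree `p ^ l`.
  rcases le_or_gt n l with hl | hl
  · have hl1 : ω ^ p ^ l = 1 := by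
      rw [← Nat.add_sub_cancel' hl, pow_add, pow_mul, hω, one_pow]
    simp only [hl1, sub_self, zero_mul, Finset.sum_const_zero]
    refine (Finset.sum_eq_zero fun i hi => ?_).symm
    have hi := Finset.mem_range.1 hi
    rw [if_neg (by omega), ← pow_mul, ← pow_add, Nat.add_sub_cancel' (by omega), hl1,
      sub_self, mul_zero, mul_zero]
  · rw [← Finset.sum_subset (Finset.range_subset_range.2 (Nat.succ_le_of_lt hl))]
    · refine Finset.sum_congr rfl fun i hi => ?_
      have hi := Finset.mem_range.1 hi
      rw [if_neg (by omega), ← pow_mul ω, ← pow_add p, Nat.add_sub_cancel' (by omega)]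
      push_cast
      ring
    · intro i _ hi
      rw [if_pos (by simpa using hi), mul_zero]

include hω in
theorem ESeries_add [IsAddTorsionFree R] (x y : WittVector p R) :
    ESeries p ω n (x + y) = ESeries p ω n x * ESeries p ω n y := by
  refine (hasLogDeriv_ESeries p n hω (x + y)).unique ?_
  convert (hasLogDeriv_ESeries p n hω x).mul (hasLogDeriv_ESeries p n hω y) using 1
  rw [pSeries_add]
  congr 1
  ext l
  simp only [map_add, Pi.add_apply]
  ring

theorem expand_ESeries_wittSigma (x : WittVector p R) :
    FSeries p ω n x * PowerSeries.expand p hp.out.ne_zero (ESeries p ω n (wittSigma p x)) =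
      ESeries p ω n x := by
  rw [FSeries, ESeries, ESeries, map_prod, ← Finset.prod_mul_distrib]
  refine Finset.prod_congr rfl fun i _ => ?_
  have h : PowerSeries.expand p hp.out.ne_zero
      (PowerSeries.expand (p ^ i) (pow_ne_zero i hp.out.ne_zero)
        (PowerSeries.rescale ((wittSigma p x).coeff i) (EInt p (ω ^ p ^ i)))) =
      PowerSeries.expand (p ^ i) (pow_ne_zero i hp.out.ne_zero) (PowerSeries.rescale (x.coeff i)
        (PowerSeries.expand p hp.out.ne_zero (EInt p (ω ^ p ^ i)))) := by
    rw [← expand_mul, coeff_wittSigma]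
    have h2 := expand_mul (p ^ i) (pow_ne_zero i hp.out.ne_zero) p hp.out.ne_zero
      (PowerSeries.rescale (x.coeff i ^ p) (EInt p (ω ^ p ^ i)))
    have h3 : PowerSeries.expand p hp.out.ne_zero
        (PowerSeries.rescale (x.coeff i ^ p) (EInt p (ω ^ p ^ i))) =
        PowerSeries.rescale (x.coeff i) (PowerSeries.expand p hp.out.ne_zero
          (EInt p (ω ^ p ^ i))) := by
      ext k
      rw [coeff_rescale, coeff_expand, coeff_rescale, coeff_expand]
      split_ifs with hk
      · obtain ⟨m, rfl⟩ := hk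
        rw [Nat.mul_div_cancel_left _ hp.out.pos, pow_mul]
      · simp
    rw [← h3, ← h2]
    congr 1
    simp only [mul_comm]
  rw [h, ← map_mul, ← map_mul, FInt_mul_expand_EInt]

include hω in
-- Divide the multiplicativity of `ESeries` at `x, y` by the one for `wittSigma p (x + y)` split
-- into the correction, `wittSigma p x` and `wittSigma p y`; the common factors have constant term
-- `1`, hence cancel.
theorem FSeries_add [IsAddTorsionFree R] (x y : WittVector p R) :
    FSeries p ω n (x + y) * PowerSeries.expand p hp.out.ne_zero
        (ESeries p ω n (wittSigma p (x + y) - wittSigma p x - wittSigma p y)) =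
      FSeries p ω n x * FSeries p ω n y := by
  have hE := fun x => hasLogDeriv_ESeries p n hω x
  have h := expand_ESeries_wittSigma (ω := ω) p n (x + y)
  rw [ESeries_add p n hω, ← expand_ESeries_wittSigma p n x,
    ← expand_ESeries_wittSigma p n y] at h
  rw [show wittSigma p (x + y) = (wittSigma p (x + y) - wittSigma p x - wittSigma p y) +
    wittSigma p x + wittSigma p y by ring, ESeries_add p n hω, ESeries_add p n hω,
    map_mul, map_mul] at h
  obtain ⟨a, ha⟩ := ((hE (wittSigma p x)).expand p hp.out.ne_zero).exists_mul_eq_one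
  obtain ⟨b, hb⟩ := ((hE (wittSigma p y)).expand p hp.out.ne_zero).exists_mul_eq_one
  set u := PowerSeries.expand p hp.out.ne_zero (ESeries p ω n (wittSigma p x))
  set v := PowerSeries.expand p hp.out.ne_zero (ESeries p ω n (wittSigma p y))
  have huv : u * v * (a * b) = 1 := by rw [mul_mul_mul_comm, ha, hb, one_mul]
  linear_combination (a * b) * h + (FSeries p ω n x * FSeries p ω n y - FSeries p ω n (x + y) *
    PowerSeries.expand p hp.out.ne_zero
      (ESeries p ω n (wittSigma p (x + y) - wittSigma p x - wittSigma p y))) * huv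

end WittSeries

/-! ### Convergence in linearly topologized rings. -/

section Evaluation

variable {R : Type*} [CommRing R] [UniformSpace R]

/-- The value `∑ f_k r ^ k`. -/
def value (f : PowerSeries R) (r : R) : R := ∑' k, coeff k f * r ^ k

theorem value_zero [T2Space R] (f : PowerSeries R) : value f 0 = constantCoeff f := by
  rw [value, tsum_eq_single 0 fun k hk => by rw [zero_pow hk, mul_zero]]
  simp

variable [IsUniformAddGroup R] [IsTopologicalRing R] [IsLinearTopology R R] [CompleteSpace R]

theorem hasCoeffSum_rescale_of_tendsto {f : PowerSeries R} {r : R}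
    (h : Tendsto (fun k => coeff k f * r ^ k) atTop (𝓝 0)) :
    HasCoeffSum (PowerSeries.rescale r f) (value f r) := by
  have := nonarchimedeanRing_of_isLinearTopology R
  rw [← Nat.cofinite_eq_atTop] at h
  refine (NonarchimedeanAddGroup.summable_of_tendsto_cofinite_zero h).hasSum.congr_fun fun k => ?_
  rw [coeff_rescale, mul_comm]

/-- Summable coefficients tend to `0`, and in a linear topology multiplying by arbitrary `r ^ k`
preserves this. So `F` can be evaluated at every `r`. -/
theorem HasCoeffSum.rescale {f : PowerSeries R} {s : R} (h : HasCoeffSum f s) (r : R) :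
    HasCoeffSum (PowerSeries.rescale r f) (value f r) := by
  refine hasCoeffSum_rescale_of_tendsto ?_
  have h1 := (HasSum.summable h).tendsto_cofinite_zero
  rw [Nat.cofinite_eq_atTop] at h1
  exact IsLinearTopology.tendsto_mul_zero_of_left _ _ h1

theorem hasCoeffSum_rescale_of_isTopologicallyNilpotent (f : PowerSeries R) {r : R}
    (hr : IsTopologicallyNilpotent r) : HasCoeffSum (PowerSeries.rescale r f) (value f r) :=
  hasCoeffSum_rescale_of_tendsto (IsLinearTopology.tendsto_mul_zero_of_right _ _ hr)

end Evaluation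

/-! ### Witt vectors with topologically nilpotent coordinates. -/

section NilWitt

variable (p : ℕ) [hp : Fact p.Prime] {R : Type*} [CommRing R]

theorem wittSigma_zero : wittSigma p (0 : WittVector p R) = 0 := by
  ext i
  rw [coeff_wittSigma, WittVector.zero_coeff, zero_pow hp.out.ne_zero]

theorem wittSigma_one : wittSigma p (1 : WittVector p R) = 1 := by
  ext i
  rw [coeff_wittSigma]
  rcases Nat.eq_zero_or_pos i with rfl | hi
  · rw [WittVector.one_coeff_zero, one_pow]
  · rw [WittVector.one_coeff_eq_of_pos _ _ _ hi, zero_pow hp.out.ne_zero]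

variable [TopologicalSpace R] [IsLinearTopology R R]

/-- Witt vectors all of whose coordinates are topologically nilpotent. -/
def nilWitt : Ideal (WittVector p R) :=
  RingHom.ker (WittVector.map (Ideal.Quotient.mk (topologicalNilradical R)))

theorem mem_nilWitt_iff {x : WittVector p R} :
    x ∈ nilWitt p ↔ ∀ i, IsTopologicallyNilpotent (x.coeff i) := by
  simp only [nilWitt, RingHom.mem_ker, WittVector.ext_iff, WittVector.map_coeff,
    WittVector.zero_coeff, Ideal.Quotient.eq_zero_iff_mem, IsTopologicallyNilpotent.mem_topologicalNilradical_iff]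

variable (hres : ∀ r : R, IsTopologicallyNilpotent (r ^ p - r))

include hres in
-- Modulo the topological nilradical every element satisfies `r ^ p = r`, so the coordinatewise
-- `p`-th power becomes the identity there.
theorem wittSigma_sub_mem (x : WittVector p R) : wittSigma p x - x ∈ nilWitt p := by
  rw [nilWitt, RingHom.mem_ker, map_sub, sub_eq_zero]
  ext i
  rw [WittVector.map_coeff, WittVector.map_coeff, coeff_wittSigma, Ideal.Quotient.mk_eq_mk_iff_sub_mem,
    IsTopologicallyNilpotent.mem_topologicalNilradical_iff]
  exact hres _

include hres in
theorem wittSigma_add_sub_mem (x y : WittVector p R) :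
    wittSigma p (x + y) - wittSigma p x - wittSigma p y ∈ nilWitt p := by
  have h := (nilWitt p).sub_mem ((nilWitt p).sub_mem (wittSigma_sub_mem p hres (x + y))
    (wittSigma_sub_mem p hres x)) (wittSigma_sub_mem p hres y)
  convert h using 1
  ring

include hres in
theorem wittSigma_sub_sub_sub_mem (a b x : WittVector p R) :
    wittSigma p (a + b + x) - wittSigma p a - wittSigma p b - x ∈ nilWitt p := by
  have h := (nilWitt p).sub_mem ((nilWitt p).sub_mem (wittSigma_sub_mem p hres (a + b + x))
    (wittSigma_sub_mem p hres a)) (wittSigma_sub_mem p hres b)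
  convert h using 1
  ring

theorem wittSigma_mem {x : WittVector p R} (hx : x ∈ nilWitt p) : wittSigma p x ∈ nilWitt p := by
  rw [mem_nilWitt_iff] at hx ⊢
  intro i
  rw [coeff_wittSigma, ← IsTopologicallyNilpotent.mem_topologicalNilradical_iff]
  exact Ideal.pow_mem_of_mem _ (IsTopologicallyNilpotent.mem_topologicalNilradical_iff.2 (hx i)) p hp.out.pos

end NilWitt

/-! ### The identities at `T = 1`. -/

section WittEvaluation

variable (p : ℕ) [hp : Fact p.Prime] {R : Type*} [CommRing R] [Algebra ℤ_[p] R] [UniformSpace R]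
  (ω : R) (n : ℕ)

/-- The value `∏ i, E_{ω ^ (p ^ i)}(x_i)` for a Witt vector `x`. -/
def EValue (x : WittVector p R) : R :=
  ∏ i ∈ Finset.range n, value (EInt p (ω ^ p ^ i)) (x.coeff i)

/-- The value `∏ i, F_{ω ^ (p ^ i)}(x_i)` for a Witt vector `x`. -/
def FValue (x : WittVector p R) : R :=
  ∏ i ∈ Finset.range n, value (FInt p (ω ^ p ^ i)) (x.coeff i)

theorem EValue_zero [T2Space R] : EValue p ω n 0 = 1 := by
  refine Finset.prod_eq_one fun i _ => ?_
  rw [WittVector.zero_coeff, value_zero, (hasLogDeriv_EInt p _).1]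

variable [IsUniformAddGroup R] [IsTopologicalRing R] [IsLinearTopology R R] [CompleteSpace R]

variable {ω} (hω : ω ^ p ^ n = 1) (hF : ∀ i, HasCoeffSum (FInt p (ω ^ p ^ i)) (ω ^ p ^ i))
  (hres : ∀ r : R, IsTopologicallyNilpotent (r ^ p - r))

theorem hasCoeffSum_ESeries {x : WittVector p R} (hx : x ∈ nilWitt p) :
    HasCoeffSum (ESeries p ω n x) (EValue p ω n x) := by
  have := nonarchimedeanRing_of_isLinearTopology R
  exact HasCoeffSum.prod _ fun i _ => (hasCoeffSum_rescale_of_isTopologicallyNilpotent _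
    ((mem_nilWitt_iff p).1 hx i)).expand _ _

include hF in
theorem hasCoeffSum_FSeries (x : WittVector p R) :
    HasCoeffSum (FSeries p ω n x) (FValue p ω n x) := by
  have := nonarchimedeanRing_of_isLinearTopology R
  exact HasCoeffSum.prod _ fun i _ => ((hF _).rescale _).expand _ _

variable [IsAddTorsionFree R] [T2Space R]

include hω in
theorem EValue_add {x y : WittVector p R} (hx : x ∈ nilWitt p) (hy : y ∈ nilWitt p) :
    EValue p ω n (x + y) = EValue p ω n x * EValue p ω n y := by
  have := nonarchimedeanRing_of_isLinearTopology R
  have h := hasCoeffSum_ESeries p n (ω := ω) ((nilWitt p).add_mem hx hy)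
  rw [ESeries_add p n hω] at h
  exact h.unique ((hasCoeffSum_ESeries p n hx).mul (hasCoeffSum_ESeries p n hy))

include hF in
omit [IsAddTorsionFree R] in
theorem FValue_mul_EValue_wittSigma {x : WittVector p R} (hx : x ∈ nilWitt p) :
    FValue p ω n x * EValue p ω n (wittSigma p x) = EValue p ω n x := by
  have := nonarchimedeanRing_of_isLinearTopology R
  have h := (hasCoeffSum_FSeries p n hF x).mul
    ((hasCoeffSum_ESeries p n (ω := ω) (wittSigma_mem p hx)).expand p hp.out.ne_zero)
  rw [expand_ESeries_wittSigma] at h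
  exact h.unique (hasCoeffSum_ESeries p n hx)

include hF in
omit [IsAddTorsionFree R] in
theorem FValue_zero : FValue p ω n 0 = 1 := by
  have h := FValue_mul_EValue_wittSigma p n hF (nilWitt p).zero_mem
  rwa [wittSigma_zero, EValue_zero, mul_one] at h

include hω hF hres in
theorem FValue_add (x y : WittVector p R) :
    FValue p ω n (x + y) * EValue p ω n (wittSigma p (x + y) - wittSigma p x - wittSigma p y) =
      FValue p ω n x * FValue p ω n y := by
  have := nonarchimedeanRing_of_isLinearTopology R
  have h := (hasCoeffSum_FSeries p n hF (x + y)).mul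
    ((hasCoeffSum_ESeries p n (ω := ω) (wittSigma_add_sub_mem p hres x y)).expand p hp.out.ne_zero)
  rw [FSeries_add p n hω] at h
  exact h.unique ((hasCoeffSum_FSeries p n hF x).mul (hasCoeffSum_FSeries p n hF y))

include hω hF hres in
-- With `δ` the correction for the pair `x, -x`, additivity gives `F(x) F(-x) = E(δ)`, and `E(δ)
-- E(-δ) = 1`.
theorem isUnit_FValue (x : WittVector p R) : IsUnit (FValue p ω n x) := by
  have h := FValue_add p n hω hF hres x (-x)
  have hδ := wittSigma_add_sub_mem p hres x (-x)
  have h1 := EValue_add p n hω hδ (neg_mem hδ)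
  rw [add_neg_cancel, EValue_zero] at h1
  rw [add_neg_cancel, FValue_zero p n hF, one_mul] at h
  rw [add_neg_cancel, h, mul_assoc] at h1
  exact IsUnit.of_mul_eq_one _ h1.symm

/-- The homomorphism `m ↦ F(m) E(σ(m) - m)`. -/
def intHom : Multiplicative ℤ →* R where
  toFun m := FValue p ω n (m.toAdd : WittVector p R) *
    EValue p ω n (wittSigma p (m.toAdd : WittVector p R) - (m.toAdd : WittVector p R))
  map_one' := by
    rw [toAdd_one, Int.cast_zero, wittSigma_zero, sub_zero, FValue_zero p n hF, EValue_zero,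
      one_mul]
  map_mul' a b := by
    rw [toAdd_mul, Int.cast_add]
    set x : WittVector p R := (a.toAdd : WittVector p R)
    set y : WittVector p R := (b.toAdd : WittVector p R)
    have h := FValue_add p n hω hF hres x y
    rw [show wittSigma p (x + y) - (x + y) =
        (wittSigma p (x + y) - wittSigma p x - wittSigma p y) +
        ((wittSigma p x - x) + (wittSigma p y - y)) by ring,
      EValue_add p n hω (wittSigma_add_sub_mem p hres x y)
        ((nilWitt p).add_mem (wittSigma_sub_mem p hres x) (wittSigma_sub_mem p hres y)),
      EValue_add p n hω (wittSigma_sub_mem p hres x) (wittSigma_sub_mem p hres y)]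
    linear_combination EValue p ω n (wittSigma p x - x) * EValue p ω n (wittSigma p y - y) * h

theorem intHom_ofAdd_one (hn : 0 < n) :
    intHom p n hω hF hres (Multiplicative.ofAdd 1) = ω := by
  change FValue p ω n ((1 : ℤ) : WittVector p R) * EValue p ω n
    (wittSigma p ((1 : ℤ) : WittVector p R) - ((1 : ℤ) : WittVector p R)) = ω
  -- Since `σ(1) = 1` the `E` factor is trivial. The coordinates of `1` past the first vanish and
  -- contribute `F(0) = 1`, leaving `F_ω(1) = ω`.
  rw [Int.cast_one, wittSigma_one, sub_self, EValue_zero, mul_one, FValue,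
    Finset.prod_eq_single_of_mem 0 (Finset.mem_range.2 hn)]
  · have h0 := hF 0
    rw [pow_zero, pow_one] at h0
    have h := h0.rescale 1
    rw [rescale_one] at h
    rw [WittVector.one_coeff_zero, pow_zero, pow_one]
    exact h.unique h0
  · intro i _ hi
    rw [WittVector.one_coeff_eq_of_pos _ _ _ (Nat.pos_of_ne_zero hi), value_zero, FInt, map_mul,
      constantCoeff_expand, (hasLogDeriv_EInt p _).1, one_mul,
      ((hasLogDeriv_EInt p _).of_mul_eq_one (EInt_mul_EIntInv p _)).1]

theorem FValue_mul_EValue_eq (a b : WittVector p R) (m : ℤ) :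
    FValue p ω n (a + b + (m : WittVector p R)) *
        EValue p ω n (wittSigma p (a + b + (m : WittVector p R)) - wittSigma p a - wittSigma p b -
          (m : WittVector p R)) =
      FValue p ω n a * FValue p ω n b * intHom p n hω hF hres (Multiplicative.ofAdd m) := by
  have h1 := FValue_add p n hω hF hres (a + b) m
  have h2 := FValue_add p n hω hF hres a b
  change _ = FValue p ω n a * FValue p ω n b * (FValue p ω n (m : WittVector p R) *
    EValue p ω n (wittSigma p (m : WittVector p R) - (m : WittVector p R)))
  set x : WittVector p R := (m : WittVector p R)
  rw [show wittSigma p (a + b + x) - wittSigma p a - wittSigma p b - x =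
      (wittSigma p (a + b + x) - wittSigma p (a + b) - wittSigma p x) +
      ((wittSigma p (a + b) - wittSigma p a - wittSigma p b) + (wittSigma p x - x)) by ring,
    EValue_add p n hω (wittSigma_add_sub_mem p hres _ _)
      ((nilWitt p).add_mem (wittSigma_add_sub_mem p hres a b) (wittSigma_sub_mem p hres x)),
    EValue_add p n hω (wittSigma_add_sub_mem p hres a b) (wittSigma_sub_mem p hres x)]
  linear_combination EValue p ω n (wittSigma p (a + b) - wittSigma p a - wittSigma p b) *
    EValue p ω n (wittSigma p x - x) * h1 + FValue p ω n x * EValue p ω n (wittSigma p x - x) * h2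

theorem FValue_mul_EValue_eq_of_mem (a : WittVector p R) {b : WittVector p R} (hb : b ∈ nilWitt p)
    (m : ℤ) :
    FValue p ω n (a + b + (m : WittVector p R)) *
        EValue p ω n (wittSigma p (a + b + (m : WittVector p R)) - wittSigma p a - b -
          (m : WittVector p R)) =
      FValue p ω n a * intHom p n hω hF hres (Multiplicative.ofAdd m) := by
  have h1 := FValue_mul_EValue_eq p n hω hF hres a b m
  have h2 := FValue_mul_EValue_wittSigma p n hF hb
  have h3 := EValue_add p n hω (wittSigma_mem p hb) (neg_mem hb)
  have h4 := EValue_add p n hω hb (neg_mem hb)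
  rw [add_neg_cancel, EValue_zero] at h4
  set x : WittVector p R := (m : WittVector p R)
  rw [show wittSigma p (a + b + x) - wittSigma p a - b - x =
      (wittSigma p (a + b + x) - wittSigma p a - wittSigma p b - x) +
      (wittSigma p b + -b) by ring,
    EValue_add p n hω (wittSigma_sub_sub_sub_mem p hres a b _)
      ((nilWitt p).add_mem (wittSigma_mem p hb) (neg_mem hb)), h3]
  linear_combination EValue p ω n (wittSigma p b) * EValue p ω n (-b) * h1 +
    FValue p ω n a * intHom p n hω hF hres (Multiplicative.ofAdd m) *
      (EValue p ω n (-b) * h2 - h4)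

end WittEvaluation

/-! ### Linear topology of an ultrametric unit ball. -/

section UnitBall

variable {A : Type*} [NormedCommRing A] [IsUltrametricDist A] (hA : ∀ x : A, ‖x‖ ≤ 1)

/-- The open ball around `0` in an ultrametric ring all of whose elements have norm at most `1`. -/
def ballIdeal (ε : ℝ) (hε : 0 < ε) : Ideal A where
  carrier := Metric.ball 0 ε
  zero_mem' := Metric.mem_ball_self hε
  add_mem' {x y} hx hy := by
    rw [mem_ball_zero_iff] at *
    exact (IsUltrametricDist.norm_add_le_max x y).trans_lt (max_lt hx hy)
  smul_mem' c x hx := by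
    rw [mem_ball_zero_iff] at *
    exact ((norm_mul_le c x).trans (mul_le_of_le_one_left (norm_nonneg x) (hA c))).trans_lt hx

theorem mem_ballIdeal {ε : ℝ} {hε : 0 < ε} {x : A} : x ∈ ballIdeal hA ε hε ↔ ‖x‖ < ε :=
  mem_ball_zero_iff

include hA in
theorem isLinearTopology_of_norm_le_one : IsLinearTopology A A := by
  refine IsLinearTopology.mk_of_hasBasis' A (ι := {ε : ℝ // 0 < ε}) (p := fun _ => True)
    (s := fun ε => ballIdeal hA ε.1 ε.2) ?_ fun I r m hm => I.smul_mem r hm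
  refine Metric.nhds_basis_ball.to_hasBasis (fun ε hε => ⟨⟨ε, hε⟩, trivial, subset_rfl⟩)
    fun ε _ => ⟨ε.1, ε.2, subset_rfl⟩

end UnitBall

/-! ### The ring `ℤ_p[z]`: completeness and residue field. -/

section Adjoin

variable (p : ℕ) [hp : Fact p.Prime]

theorem norm_algebraMap_padicAlgCl (x : ℤ_[p]) : ‖algebraMap ℤ_[p] (PadicAlgCl p) x‖ = ‖x‖ := by
  rw [IsScalarTower.algebraMap_apply ℤ_[p] ℚ_[p] (PadicAlgCl p), norm_algebraMap']
  rfl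

theorem continuousSMul_padicAlgCl : ContinuousSMul ℤ_[p] (PadicAlgCl p) := by
  have h : Continuous (algebraMap ℤ_[p] (PadicAlgCl p)) :=
    AddMonoidHomClass.continuous_of_bound (algebraMap ℤ_[p] (PadicAlgCl p)) 1
      fun x => by rw [norm_algebraMap_padicAlgCl, one_mul]
  refine ⟨?_⟩
  simp only [Algebra.smul_def]
  exact (h.comp continuous_fst).mul continuous_snd

variable {p} {z : PadicAlgCl p}

theorem norm_algebraMap_zpAdjoin (x : ℤ_[p]) : ‖algebraMap ℤ_[p] (ZpAdjoin p z) x‖ = ‖x‖ :=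
  norm_algebraMap_padicAlgCl p x

/-- `PadicAlgCl p` is not complete, but `ℤ_p[z]` is a finitely generated module over the compact
ring `ℤ_p`, hence compact. -/
theorem completeSpace_zpAdjoin (hz : IsIntegral ℤ_[p] z) : CompleteSpace (ZpAdjoin p z) := by
  have := continuousSMul_padicAlgCl p
  have h := Submodule.isCompact_of_fg hz.fg_adjoin_singleton
  exact h.isComplete.completeSpace_coe

variable {N : ℕ} (hz : z ^ p ^ N = 1)

include hz in
theorem isIntegral_of_pow_eq_one : IsIntegral ℤ_[p] z := by
  refine IsIntegral.of_pow (pow_pos hp.out.pos N) ?_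
  rw [hz]
  exact isIntegral_one

include hz in
theorem norm_zpAdjoin_le_one (x : ZpAdjoin p z) : ‖x‖ ≤ 1 := by
  obtain ⟨x, hx⟩ := x
  change ‖x‖ ≤ 1
  induction hx using Algebra.adjoin_induction with
  | mem x hx =>
    rw [Set.mem_singleton_iff.1 hx]
    refine (pow_le_one_iff_of_nonneg (norm_nonneg z) (pow_ne_zero N hp.out.ne_zero)).1 ?_
    rw [← norm_pow, hz, norm_one]
  | algebraMap r =>
    rw [norm_algebraMap_padicAlgCl]
    exact PadicInt.norm_le_one r
  | add x y _ _ hx hy => exact (IsUltrametricDist.norm_add_le_max x y).trans (max_le hx hy)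
  | mul x y _ _ hx hy =>
    rw [norm_mul]
    exact mul_le_one₀ hx (norm_nonneg y) hy

variable (z) in
/-- The generator `z` of `ℤ_p[z]`. -/
def gen : ZpAdjoin p z := ⟨z, Algebra.self_mem_adjoin_singleton ℤ_[p] z⟩

theorem norm_natCast_prime_lt_one : ‖(p : ZpAdjoin p z)‖ < 1 := by
  rw [← map_natCast (algebraMap ℤ_[p] (ZpAdjoin p z)), norm_algebraMap_zpAdjoin]
  exact PadicInt.norm_lt_one_iff_dvd _ |>.2 dvd_rfl

include hz in
-- For `w ^ p ^ N = 1`, the binomial expansion makes `(w - 1) ^ p ^ N` divisible by `p`, and the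
-- norm is multiplicative.
theorem norm_pow_prime_pow_sub_one_lt_one (i : ℕ) : ‖gen z ^ p ^ i - 1‖ < 1 := by
  have hz' : gen z ^ p ^ N = 1 := Subtype.ext hz
  set w := gen z ^ p ^ i
  have hw : w ^ p ^ N = 1 := by rw [← pow_mul, mul_comm, pow_mul, hz', one_pow]
  obtain ⟨r, hr⟩ := exists_add_pow_prime_pow_eq hp.out (w - 1) 1 N
  rw [sub_add_cancel, hw, one_pow, mul_one] at hr
  have h1 : (w - 1) ^ p ^ N = (p : ZpAdjoin p z) * (-((w - 1) * r)) := by linear_combination -hr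
  have h2 : ‖(w - 1) ^ p ^ N‖ < 1 := by
    rw [h1]
    exact ((norm_mul_le _ _).trans (mul_le_of_le_one_right (norm_nonneg _)
      (norm_zpAdjoin_le_one hz _))).trans_lt norm_natCast_prime_lt_one
  have h3 : ‖(w - 1) ^ p ^ N‖ = ‖w - 1‖ ^ p ^ N :=
    norm_pow ((w - 1 : ZpAdjoin p z) : PadicAlgCl p) (p ^ N)
  rw [h3] at h2
  exact (pow_lt_one_iff_of_nonneg (norm_nonneg _) (pow_ne_zero N hp.out.ne_zero)).1 h2

include hz in
/-- The residue field of `ℤ_p[z]` is the prime field. -/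
theorem norm_pow_prime_sub_self_lt_one (x : ZpAdjoin p z) : ‖x ^ p - x‖ < 1 := by
  have hA := norm_zpAdjoin_le_one hz
  have hpI : (p : ZpAdjoin p z) ∈ ballIdeal hA 1 one_pos :=
    (mem_ballIdeal hA).2 norm_natCast_prime_lt_one
  rw [← mem_ballIdeal hA (hε := one_pos)]
  set I := ballIdeal hA 1 one_pos
  obtain ⟨x, hx⟩ := x
  induction hx using Algebra.adjoin_induction with
  | mem x hx =>
    obtain rfl := Set.mem_singleton_iff.1 hx
    have h1 : gen x ^ p - 1 ∈ I := by
      have := norm_pow_prime_pow_sub_one_lt_one hz 1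
      rw [pow_one] at this
      exact (mem_ballIdeal hA).2 this
    have h0 : gen x - 1 ∈ I := by
      have := norm_pow_prime_pow_sub_one_lt_one hz 0
      rw [pow_zero, pow_one] at this
      exact (mem_ballIdeal hA).2 this
    have h2 := I.sub_mem h1 h0
    rw [sub_sub_sub_cancel_right] at h2
    exact h2
  | algebraMap r =>
    have h : r ^ p - r ∈ RingHom.ker (PadicInt.toZMod (p := p)) := by
      rw [RingHom.mem_ker, map_sub, map_pow, ZMod.pow_card, sub_self]
    rw [PadicInt.ker_toZMod, IsLocalRing.mem_maximalIdeal, PadicInt.mem_nonunits] at h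
    rw [← norm_algebraMap_zpAdjoin (z := z), map_sub, map_pow] at h
    exact (mem_ballIdeal hA).2 h
  | add x y hx hy ihx ihy =>
    obtain ⟨r, hr⟩ := exists_add_pow_prime_eq hp.out (⟨x, hx⟩ : ZpAdjoin p z) ⟨y, hy⟩
    have h := I.add_mem (I.add_mem ihx ihy)
      (I.mul_mem_right ((⟨x, hx⟩ : ZpAdjoin p z) * ⟨y, hy⟩ * r) hpI)
    convert h using 1
    change ((⟨x, hx⟩ : ZpAdjoin p z) + ⟨y, hy⟩) ^ p - (⟨x, hx⟩ + ⟨y, hy⟩) = _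
    rw [hr]
    ring
  | mul x y hx hy ihx ihy =>
    have h := I.add_mem (I.mul_mem_right ((⟨y, hy⟩ : ZpAdjoin p z) ^ p) ihx)
      (I.mul_mem_left (⟨x, hx⟩ : ZpAdjoin p z) ihy)
    convert h using 1
    change ((⟨x, hx⟩ : ZpAdjoin p z) * ⟨y, hy⟩) ^ p - (⟨x, hx⟩ * ⟨y, hy⟩) = _
    ring

theorem isTopologicallyNilpotent_of_norm_lt_one {A : Type*} [NormedCommRing A] {x : A}
    (hx : ‖x‖ < 1) : IsTopologicallyNilpotent x :=
  tendsto_pow_atTop_nhds_zero_of_norm_lt_one hx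

end Adjoin

/-! ### Passage to `ℤ_p[z]⟦a, b⟧` and its inclusion over the field. -/

section IntSeries

variable {p : ℕ} [hp : Fact p.Prime] {z : PadicAlgCl p} {n N : ℕ} (hz : z ^ p ^ N = 1)

instance : IsAddTorsionFree (IntSeries p n z) :=
  inferInstanceAs (IsAddTorsionFree ((Fin n ⊕ Fin n →₀ ℕ) → ZpAdjoin p z))

include hz in
theorem isLinearTopology_zpAdjoin : IsLinearTopology (ZpAdjoin p z) (ZpAdjoin p z) :=
  isLinearTopology_of_norm_le_one (norm_zpAdjoin_le_one hz)

include hz in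
theorem isTopologicallyNilpotent_pow_prime_sub_self (r : IntSeries p n z) :
    IsTopologicallyNilpotent (r ^ p - r) := by
  have := isLinearTopology_zpAdjoin hz
  refine MvPowerSeries.LinearTopology.isTopologicallyNilpotent_of_constantCoeff ?_
  rw [map_sub, map_pow]
  exact isTopologicallyNilpotent_of_norm_lt_one (norm_pow_prime_sub_self_lt_one hz _)

theorem continuous_incl : Continuous (incl p n z) :=
  continuous_pi fun d => continuous_subtype_val.comp (MvPowerSeries.WithPiTopology.continuous_coeff _ d)

theorem incl_C (w : ZpAdjoin p z) : incl p n z (MvPowerSeries.C w) = MvPowerSeries.C (w : PadicAlgCl p) := by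
  rw [incl, MvPowerSeries.map_C]
  rfl

/-- The embedding of constants into `ℤ_p[z]⟦a, b⟧`. -/
def constHom : ZpAdjoin p z →ₐ[ℤ_[p]] IntSeries p n z where
  toRingHom := MvPowerSeries.C
  commutes' _ := MvPowerSeries.algebraMap_apply.symm

theorem FInt_const (w : ZpAdjoin p z) :
    FInt p (MvPowerSeries.C w : IntSeries p n z) = PowerSeries.map MvPowerSeries.C (FInt p w) :=
  (map_FInt p (constHom (n := n)) w).symm

theorem EInt_const (w : ZpAdjoin p z) :
    EInt p (MvPowerSeries.C w : IntSeries p n z) = PowerSeries.map MvPowerSeries.C (EInt p w) :=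
  (map_EInt p (constHom (n := n)) w).symm

theorem F_coe (w : ZpAdjoin p z) :
    F p (w : PadicAlgCl p) = PowerSeries.map (algebraMap (ZpAdjoin p z) (PadicAlgCl p)) (FInt p w) := by
  rw [F_eq_FInt]
  exact (map_FInt p (ZpAdjoin p z).val w).symm

theorem E_coe (w : ZpAdjoin p z) :
    E p (w : PadicAlgCl p) = PowerSeries.map (algebraMap (ZpAdjoin p z) (PadicAlgCl p)) (EInt p w) := by
  rw [E_eq_EInt]
  exact (map_EInt p (ZpAdjoin p z).val w).symm

include hz in
theorem hasCoeffSum_FInt_const (i : ℕ) :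
    HasCoeffSum (FInt p ((MvPowerSeries.C (gen z) : IntSeries p n z) ^ p ^ i))
      (MvPowerSeries.C (gen z) ^ p ^ i) := by
  have := completeSpace_zpAdjoin (isIntegral_of_pow_eq_one hz)
  have h := hasCoeffSum_FInt p (fun x => (norm_algebraMap_zpAdjoin (z := z) x).le)
    (norm_pow_prime_pow_sub_one_lt_one hz i)
  rw [← map_pow, FInt_const]
  have h1 := HasSum.map h (MvPowerSeries.C : ZpAdjoin p z →+* IntSeries p n z)
    MvPowerSeries.WithPiTopology.continuous_C
  refine h1.congr_fun fun k => ?_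
  rw [coeff_map]
  rfl

theorem hasSum_monoTerm {f : PowerSeries (ZpAdjoin p z)} {r s : IntSeries p n z}
    (h : HasCoeffSum (PowerSeries.rescale r (PowerSeries.map MvPowerSeries.C f)) s) :
    HasSum (monoTerm p (PowerSeries.map (algebraMap (ZpAdjoin p z) (PadicAlgCl p)) f) r)
      (incl p n z s) := by
  refine (HasSum.map h (incl p n z) continuous_incl).congr_fun fun k => ?_
  rw [monoTerm, Function.comp_apply, coeff_rescale, coeff_map, coeff_map, map_mul, map_pow, incl_C,
    MvPowerSeries.smul_eq_C_mul, mul_comm]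
  rfl

end IntSeries

/-! ### Comparison with truncated Witt vectors and the original series. -/

section Specialization

/-- Truncated subtraction is correct here: for `j ≥ k` both sides are `1`. -/
theorem pow_prime_pow_eq {M : Type*} [Monoid M] {p : ℕ} {z : ℕ → M} (hz0 : z 0 = 1)
    (hzp : ∀ k, z (k + 1) ^ p = z k) (k j : ℕ) : z k ^ p ^ j = z (k - j) := by
  induction j generalizing k with
  | zero => simp
  | succ j ih =>
    rcases k with _ | k
    · simp [hz0]
    · rw [pow_succ', pow_mul, hzp, ih, Nat.add_sub_add_right]

theorem mul_mul_eq_of_mul_eq {A : Type*} [CommRing A] {x y a g u : A} (h : x * y = a * g)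
    (hu : a * u = 1) : x * u * y = g := by
  linear_combination u * h + g * hu

theorem mul_mul_mul_eq_of_mul_eq {A : Type*} [CommRing A] {x y a b g u v : A}
    (h : x * y = a * b * g) (hu : a * u = 1) (hv : b * v = 1) : x * u * v * y = g := by
  linear_combination u * v * h + g * (v * b * hu + hv)

variable {p : ℕ} [hp : Fact p.Prime] {ζ : ℕ → PadicAlgCl p} {n : ℕ} (hζ0 : ζ 0 = 1)
  (hcompat : ∀ k, ζ (k + 1) ^ p = ζ k)

include hζ0 hcompat

theorem coe_gen_pow (i : ℕ) : ((gen (ζ n) ^ p ^ i : ZpAdjoin p (ζ n)) : PadicAlgCl p) = ζ (n - i) :=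
  pow_prime_pow_eq hζ0 hcompat n i

theorem pow_prime_pow_self_eq_one : ζ n ^ p ^ n = 1 := by
  rw [pow_prime_pow_eq hζ0 hcompat, Nat.sub_self, hζ0]

theorem hasSum_monoTerm_F (x : WittVector p (IntSeries p n (ζ n))) (i : Fin n) :
    HasSum (monoTerm p (F p (ζ (n - i))) ((WittVector.truncate n x).coeff i))
      (incl p n (ζ n) (value (FInt p (MvPowerSeries.C (gen (ζ n)) ^ p ^ (i : ℕ))) (x.coeff i))) := by
  have hz := pow_prime_pow_self_eq_one (n := n) hζ0 hcompat
  have := completeSpace_zpAdjoin (isIntegral_of_pow_eq_one hz)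
  have := isLinearTopology_zpAdjoin hz
  have h := (hasCoeffSum_FInt_const (n := n) hz i).rescale (x.coeff i)
  rw [← coe_gen_pow hζ0 hcompat, F_coe, WittVector.coeff_truncate]
  rw [← map_pow, FInt_const] at h ⊢
  exact hasSum_monoTerm h

theorem hasSum_monoTerm_E {x : WittVector p (IntSeries p n (ζ n))}
    (hx : ∀ i, IsTopologicallyNilpotent (x.coeff i)) (i : Fin n) :
    HasSum (monoTerm p (E p (ζ (n - i))) ((WittVector.truncate n x).coeff i))
      (incl p n (ζ n) (value (EInt p (MvPowerSeries.C (gen (ζ n)) ^ p ^ (i : ℕ))) (x.coeff i))) := by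
  have hz := pow_prime_pow_self_eq_one (n := n) hζ0 hcompat
  have := completeSpace_zpAdjoin (isIntegral_of_pow_eq_one hz)
  have := isLinearTopology_zpAdjoin hz
  have h := hasCoeffSum_rescale_of_isTopologicallyNilpotent
    (EInt p (MvPowerSeries.C (gen (ζ n)) ^ p ^ (i : ℕ))) (hx i)
  rw [← coe_gen_pow hζ0 hcompat, E_coe, WittVector.coeff_truncate]
  rw [← map_pow, EInt_const] at h ⊢
  exact hasSum_monoTerm h

theorem fConverges_truncate (x : WittVector p (IntSeries p n (ζ n))) :
    FConverges p ζ (WittVector.truncate n x) :=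
  fun i => (hasSum_monoTerm_F hζ0 hcompat x i).summable

theorem fWitt_truncate (x : WittVector p (IntSeries p n (ζ n))) :
    FWitt p ζ (WittVector.truncate n x) =
      incl p n (ζ n) (FValue p (MvPowerSeries.C (gen (ζ n))) n x) := by
  rw [FWitt, FValue, Finset.prod_range, map_prod]
  exact Finset.prod_congr rfl fun i _ => (hasSum_monoTerm_F hζ0 hcompat x i).tsum_eq

theorem eConverges_truncate {x : WittVector p (IntSeries p n (ζ n))}
    (hx : ∀ i, IsTopologicallyNilpotent (x.coeff i)) :
    EConverges p ζ (WittVector.truncate n x) :=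
  fun i => (hasSum_monoTerm_E hζ0 hcompat hx i).summable

theorem eWitt_truncate {x : WittVector p (IntSeries p n (ζ n))}
    (hx : ∀ i, IsTopologicallyNilpotent (x.coeff i)) :
    EWitt p ζ (WittVector.truncate n x) =
      incl p n (ζ n) (EValue p (MvPowerSeries.C (gen (ζ n))) n x) := by
  rw [EWitt, EValue, Finset.prod_range, map_prod]
  exact Finset.prod_congr rfl fun i _ => (hasSum_monoTerm_E hζ0 hcompat hx i).tsum_eq

omit hζ0 hcompat in
theorem sigma_truncate (x : WittVector p (IntSeries p n (ζ n))) :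
    sigma p (WittVector.truncate n x) = WittVector.truncate n (wittSigma p x) := by
  ext i
  rw [sigma, TruncatedWittVector.coeff_mk, WittVector.coeff_truncate, WittVector.coeff_truncate,
    coeff_wittSigma]

omit hζ0 hcompat in
theorem isTopologicallyNilpotent_coeff_out_wittB [IsLinearTopology (ZpAdjoin p (ζ n)) (ZpAdjoin p (ζ n))]
    (i : ℕ) : IsTopologicallyNilpotent ((wittB p n (ζ n)).out.coeff i) := by
  refine MvPowerSeries.LinearTopology.isTopologicallyNilpotent_of_constantCoeff ?_
  -- The lift `out` pads with zeros beyond length `n`, so every coordinate is a variable or `0`.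
  have h : MvPowerSeries.constantCoeff ((wittB p n (ζ n)).out.coeff i) = 0 := by
    rcases lt_or_ge i n with hi | hi
    · rw [TruncatedWittVector.coeff_out _ ⟨i, hi⟩, wittB, TruncatedWittVector.coeff_mk,
        MvPowerSeries.constantCoeff_X]
    · change MvPowerSeries.constantCoeff (dite (i < n) _ _) = 0
      rw [dif_neg hi.not_gt, map_zero]
  rw [h]
  exact IsTopologicallyNilpotent.zero

omit hζ0 hcompat in
theorem inv_incl_eq {u v : IntSeries p n (ζ n)} (h : u * v = 1) :
    (incl p n (ζ n) u)⁻¹ = incl p n (ζ n) v := by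
  have h1 : incl p n (ζ n) v * incl p n (ζ n) u = 1 := by rw [← map_mul, mul_comm, h, map_one]
  refine (MvPowerSeries.inv_eq_iff_mul_eq_one fun h0 => ?_).2 h1
  have := congrArg MvPowerSeries.constantCoeff h1
  rw [map_mul, h0, mul_zero, map_one] at this
  exact zero_ne_one this

omit hζ0 hcompat in
theorem incl_intHom_ofAdd [CompleteSpace (ZpAdjoin p (ζ n))]
    [IsLinearTopology (ZpAdjoin p (ζ n)) (ZpAdjoin p (ζ n))]
    (hω : (MvPowerSeries.C (gen (ζ n)) : IntSeries p n (ζ n)) ^ p ^ n = 1)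
    (hF : ∀ i, HasCoeffSum (FInt p ((MvPowerSeries.C (gen (ζ n)) : IntSeries p n (ζ n)) ^ p ^ i))
      (MvPowerSeries.C (gen (ζ n)) ^ p ^ i))
    (hres : ∀ r : IntSeries p n (ζ n), IsTopologicallyNilpotent (r ^ p - r)) (hn : 0 < n) (m : ℤ) :
    incl p n (ζ n) (intHom p n hω hF hres (Multiplicative.ofAdd m)) =
      MvPowerSeries.C (ζ n ^ m) := by
  have hne : ζ n ≠ 0 := by
    have h := congrArg (incl p n (ζ n)) hω
    rw [map_pow, incl_C, map_one] at h
    intro h0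
    rw [show ((gen (ζ n) : ZpAdjoin p (ζ n)) : PadicAlgCl p) = 0 from h0, map_zero,
      zero_pow (pow_ne_zero n hp.out.ne_zero)] at h
    exact zero_ne_one h
  let f : Multiplicative ℤ →* FieldSeries p n :=
    (MvPowerSeries.C : PadicAlgCl p →+* FieldSeries p n).toMonoidHom.comp
      ((Units.coeHom (PadicAlgCl p)).comp (zpowersHom _ (Units.mk0 (ζ n) hne)))
  have hf : ((incl p n (ζ n)).toMonoidHom.comp (intHom p n hω hF hres)) = f := by
    -- Both sides are homomorphisms from `ℤ`, so comparing them at `1` covers negative `m` too.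
    refine MonoidHom.ext_mint ?_
    change incl p n (ζ n) (intHom p n hω hF hres (Multiplicative.ofAdd 1)) = _
    rw [intHom_ofAdd_one p n hω hF hres hn, incl_C]
    simp [f, gen]
  have := DFunLike.congr_fun hf (Multiplicative.ofAdd m)
  simpa [f] using this

end Specialization

end ArtinHasse

end

/-! ### The main theorem. -/

theorem lemmaL (p : ℕ) [Fact p.Prime] (n : ℕ) (hn : 0 < n) (ζ : ℕ → PadicAlgCl p)
    (hζ : ∀ k, IsPrimitiveRoot (ζ k) (p ^ k)) (hcompat : ∀ k, ζ (k + 1) ^ p = ζ k) (m : ℤ)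
    (a b x y y' : ArtinHasse.Witt p n (ζ n))
    (ha : a = ArtinHasse.wittA p n (ζ n)) (hb : b = ArtinHasse.wittB p n (ζ n))
    (hx : x = a + b + (m : ArtinHasse.Witt p n (ζ n)))
    (hy : y = ArtinHasse.sigma p x - ArtinHasse.sigma p a - b
      - (m : ArtinHasse.Witt p n (ζ n)))
    (hy' : y' = ArtinHasse.sigma p x - ArtinHasse.sigma p a - ArtinHasse.sigma p b
      - (m : ArtinHasse.Witt p n (ζ n))) :
    -- all the expressions below are well-defined: the series converge
    (ArtinHasse.FConverges p ζ x ∧ ArtinHasse.FConverges p ζ a ∧ ArtinHasse.FConverges p ζ b ∧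
      ArtinHasse.EConverges p ζ y ∧ ArtinHasse.EConverges p ζ y') ∧
    -- and all the factors have coefficients in `ℤ_p[ζ_{p ^ n}]`
    (ArtinHasse.FWitt p ζ x ∈ ArtinHasse.integralSeries p n (ζ n) ∧
      (ArtinHasse.FWitt p ζ a)⁻¹ ∈ ArtinHasse.integralSeries p n (ζ n) ∧
      (ArtinHasse.FWitt p ζ b)⁻¹ ∈ ArtinHasse.integralSeries p n (ζ n) ∧
      ArtinHasse.EWitt p ζ y ∈ ArtinHasse.integralSeries p n (ζ n) ∧
      ArtinHasse.EWitt p ζ y' ∈ ArtinHasse.integralSeries p n (ζ n)) ∧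
    ArtinHasse.FWitt p ζ x * (ArtinHasse.FWitt p ζ a)⁻¹ * ArtinHasse.EWitt p ζ y
      = MvPowerSeries.C (ζ n ^ m) ∧
    ArtinHasse.FWitt p ζ x * (ArtinHasse.FWitt p ζ a)⁻¹ * (ArtinHasse.FWitt p ζ b)⁻¹
      * ArtinHasse.EWitt p ζ y' = MvPowerSeries.C (ζ n ^ m) := by
  open ArtinHasse in
  have hζ0 : ζ 0 = 1 := by simpa using hζ 0
  have hz : ζ n ^ p ^ n = 1 := (hζ n).pow_eq_one
  have := completeSpace_zpAdjoin (isIntegral_of_pow_eq_one hz)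
  have := isLinearTopology_zpAdjoin hz
  set ω : IntSeries p n (ζ n) := MvPowerSeries.C (gen (ζ n)) with hω_def
  have hω : ω ^ p ^ n = 1 := by
    rw [hω_def, ← map_pow, show gen (ζ n) ^ p ^ n = 1 from Subtype.ext hz, map_one]
  have hF := hasCoeffSum_FInt_const (n := n) hz
  have hres := isTopologicallyNilpotent_pow_prime_sub_self (n := n) hz
  -- Ghost components are used on full Witt vectors, so everything is lifted from length `n`;
  -- truncation is a ring homomorphism and commutes with `σ`.
  let A : WittVector p (IntSeries p n (ζ n)) := a.out
  let B : WittVector p (IntSeries p n (ζ n)) := b.out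
  let M : WittVector p (IntSeries p n (ζ n)) := (m : WittVector p (IntSeries p n (ζ n)))
  have hA : a = WittVector.truncate n A := (TruncatedWittVector.truncateFun_out a).symm
  have hB : b = WittVector.truncate n B := (TruncatedWittVector.truncateFun_out b).symm
  have hM : (m : Witt p n (ζ n)) = WittVector.truncate n M := (map_intCast _ m).symm
  have hBnil : B ∈ nilWitt p := by
    rw [mem_nilWitt_iff]
    simp only [B, hb]
    exact isTopologicallyNilpotent_coeff_out_wittB
  have hX : x = WittVector.truncate n (A + B + M) := by
    rw [hx, hA, hB, hM, map_add, map_add]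
  have hY' : y' = WittVector.truncate n
      (wittSigma p (A + B + M) - wittSigma p A - wittSigma p B - M) := by
    rw [hy', hX, hA, hB, hM, sigma_truncate, sigma_truncate, sigma_truncate, map_sub, map_sub,
      map_sub]
  have hY : y = WittVector.truncate n (wittSigma p (A + B + M) - wittSigma p A - B - M) := by
    rw [hy, hX, hA, hB, hM, sigma_truncate, sigma_truncate, map_sub, map_sub, map_sub]
  have hYnil' : wittSigma p (A + B + M) - wittSigma p A - wittSigma p B - M ∈ nilWitt p :=
    wittSigma_sub_sub_sub_mem p hres A B M
  have hYnil : wittSigma p (A + B + M) - wittSigma p A - B - M ∈ nilWitt p := by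
    convert (nilWitt p).add_mem hYnil' (wittSigma_sub_mem p hres B) using 1
    ring
  obtain ⟨u, hu⟩ := (isUnit_FValue p n hω hF hres A).exists_right_inv
  obtain ⟨v, hv⟩ := (isUnit_FValue p n hω hF hres B).exists_right_inv
  have h1 := FValue_mul_EValue_eq_of_mem p n hω hF hres A hBnil m
  have h2 := FValue_mul_EValue_eq p n hω hF hres A B m
  have hpow := incl_intHom_ofAdd hω hF hres hn m
  have hYc := (mem_nilWitt_iff p).1 hYnil
  have hYc' := (mem_nilWitt_iff p).1 hYnil'
  have eX : FWitt p ζ x = _ := hX ▸ fWitt_truncate hζ0 hcompat _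
  have eA : (FWitt p ζ a)⁻¹ = incl p n (ζ n) u := by
    rw [hA, fWitt_truncate hζ0 hcompat, inv_incl_eq hu]
  have eB : (FWitt p ζ b)⁻¹ = incl p n (ζ n) v := by
    rw [hB, fWitt_truncate hζ0 hcompat, inv_incl_eq hv]
  have eY : EWitt p ζ y = _ := hY ▸ eWitt_truncate hζ0 hcompat hYc
  have eY' : EWitt p ζ y' = _ := hY' ▸ eWitt_truncate hζ0 hcompat hYc'
  refine ⟨⟨hX ▸ fConverges_truncate hζ0 hcompat _, hA ▸ fConverges_truncate hζ0 hcompat _,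
    hB ▸ fConverges_truncate hζ0 hcompat _, hY ▸ eConverges_truncate hζ0 hcompat hYc,
    hY' ▸ eConverges_truncate hζ0 hcompat hYc'⟩, ⟨⟨_, eX.symm⟩, ⟨_, eA.symm⟩, ⟨_, eB.symm⟩,
    ⟨_, eY.symm⟩, ⟨_, eY'.symm⟩⟩, ?_, ?_⟩
  · rw [eX, eA, eY, ← hpow, ← map_mul, ← map_mul]
    exact congrArg (incl p n (ζ n)) (mul_mul_eq_of_mul_eq h1 hu)
  · rw [eX, eA, eB, eY', ← hpow, ← map_mul, ← map_mul, ← map_mul]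
    exact congrArg (incl p n (ζ n)) (mul_mul_mul_eq_of_mul_eq h2 hu hv)
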